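/- **Setting.** Let $d\ge 3$ and let $K$ be a positive, radially symmetric kernel on $\mathbb{R}^d$ of unit mass with rapid decay, i.e. a Borel probability measure that is invariant under all linear isometries and has finite moments of every order (this covers densities $K(x)\,dx$ as well as kernels concentrated on spherical shells). For $r>0$ let $K_r$ be the image of $K$ under $z\mapsto rz$ (for densities, $K_r(x)=r^{-d}K(x/r)$). The weighted median of a bounded continuous function $\varphi$ at $x$ is $$\mathbf{M}_K\varphi(x)=\sup\Big\{\lambda\in\mathbb{R}:\ K\big(\{z:\varphi(x-z)\ge\lambda\}\big)\ge\tfrac12\Big\},$$ and the weighted median filter scheme with time step $k>0$ is $\varphi^{n+1}=\mathbf{M}_{K_{\sqrt{2k}}}\varphi^n$. For $c\in\mathbb{R}$ consider the level set equation of mean curvature motion, run at speed $c$, $$u_t=c\,|\nabla u|\,\nabla\cdot\Big(\frac{\nabla u}{|\nabla u|}\Big), \qquad (\ast)_c$$ where $c=1$ is motion by mean curvature itself. The scheme is called consistent of order $p$ with $(\ast)_c$ if $$\mathbf{M}_{K_{\sqrt{2k}}}u(\cdot,0)(x)-u(x,k)=O(k^{p+1})\qquad\text{as }k\to0^+$$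 for every point $x$ and every $u$ such that $u(\cdot,0)$ is smooth and bounded on $\mathbb{R}^d$ and, for some $T>0$ and some open neighbourhood $U$ of $x$, $u$ is smooth on $U\times[0,T)$ (up to $t=0$), has $\nabla u\neq0$ there, and solves $(\ast)_c$ on $U\times(0,T)$. **Proposition.** Let $d\ge3$. 1. There is no weighted median filter scheme $\varphi^{n+1}=\mathbf{M}_{K_{\sqrt{2k}}}\varphi^n$ with $K$ as above that is consistent of order $2$ with motion by mean curvature $(\ast)_1$. 2. This is not repaired by redefining the time scale: if for some $c\in\mathbb{R}$ the scheme is consistent of order $2$ with $(\ast)_c$, then $c=0$, and then the scheme is not even consistent of order $1$ with $(\ast)_{c'}$ for any $c'\ne0$. 3. In terms of moments in $d=3$: for a radial profile $K(r)$ (of any sign) put $\langle K\rangle_n=\int_0^\infty r^nK(r)\,dr$, suppose that these integrals converge absolutely for $n=1,3,5$ and that $\langle K\rangle_1\ne0$, and let $$B_0=\frac{\langle K\rangle_3}{4\langle K\rangle_1},\quad B_1=\frac1{64}\frac{\langle K\rangle_5}{\langle K\rangle_1},\quad B_2=-\Big(\frac5{128}\frac{\langle K\rangle_5}{\langle K\rangle_1}-\frac1{32}\frac{\langle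 K\rangle_3^2}{\langle K\rangle_1^2}\Big),\quad B_3=\frac3{32}\frac{\langle K\rangle_5}{\langle K\rangle_1}-\frac1{16}\frac{\langle K\rangle_3^2}{\langle K\rangle_1^2}.$$ If the second-order matching conditions $B_0^2=2B_1$, $2B_1=-B_2$ and $6B_1=B_3$ hold, then $\langle K\rangle_5=0$ and $B_0=0$. -/

import Mathlib

open MeasureTheory Set Filter Asymptotics
open scoped Topology ContDiff Gradient

noncomputable section

namespace MedianFilter

/-- The space `ℝ^d` with its Euclidean norm. -/
abbrev Space (d : ℕ) : Type := EuclideanSpace ℝ (Fin d)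

/-! ### Mean curvature flow in level set form -/

/-- The divergence `∑ i, ∂_i V_i` of a vector field. -/
def divergence {d : ℕ} (V : Space d → Space d) (x : Space d) : ℝ :=
  ∑ i : Fin d, (fderiv ℝ V x (EuclideanSpace.single i 1)) i

/-- The level set mean curvature operator `|∇φ| ∇ · (∇φ / |∇φ|)`
(meaningful where `∇φ ≠ 0`). -/
def levelSetOp {d : ℕ} (φ : Space d → ℝ) (x : Space d) : ℝ :=
  ‖∇ φ x‖ * divergence (fun y => ‖∇ φ y‖⁻¹ • ∇ φ y) x

/-- `u` is a smooth (up to the initial time) solution on `[0, T) × U` of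
`u_t = c |∇u| ∇ · (∇u / |∇u|)` with nonvanishing spatial gradient.
For `c = 1` this is the level set equation of motion by mean curvature; for a general `c` it is
the same equation after the change `t ↦ c t` of the time scale. -/
structure IsSmoothFlow {d : ℕ} (c : ℝ) (u : ℝ → Space d → ℝ) (T : ℝ) (U : Set (Space d)) :
    Prop where
  smooth : ContDiffOn ℝ ∞ (fun p : ℝ × Space d => u p.1 p.2) (Ico 0 T ×ˢ U)
  gradient_ne_zero : ∀ t ∈ Ico 0 T, ∀ x ∈ U, ∇ (u t) x ≠ 0
  equation : ∀ t ∈ Ioo 0 T, ∀ x ∈ U, deriv (fun s => u s x) t = c * levelSetOp (u t) x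

/-! ### Weighted median filters -/

/-- A positive, radially symmetric kernel of unit mass with rapid decay (all moments are finite).
The kernel is a measure, so that both densities `K(x) dx` and kernels that are
concentrated on spherical shells are covered. -/
structure IsRadialKernel {d : ℕ} (K : Measure (Space d)) : Prop where
  unit_mass : K univ = 1
  radial : ∀ A : Space d ≃ₗᵢ[ℝ] Space d, K.map A = K
  rapid_decay : ∀ n : ℕ, Integrable (fun z => ‖z‖ ^ n) K

/-- The rescaled kernel `K_r`, the image of `K` under `z ↦ r z`; for a density `K(x) dx` and `r > 0`
this is the density `r^{-d} K(x / r) dx`. -/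
def scaledKernel {d : ℕ} (K : Measure (Space d)) (r : ℝ) : Measure (Space d) :=
  K.map (fun z => r • z)

/-- `ψ_K φ (x, l)`, the integral of `K(x - y)` over `y ∈ {φ ≥ l}`, written with `z = x - y`. -/
def superlevelMass {d : ℕ} (K : Measure (Space d)) (φ : Space d → ℝ) (x : Space d) (l : ℝ) : ℝ :=
  K.real {z | l ≤ φ (x - z)}

/-- The weighted median `M_K φ (x) = sup {l : ψ_K φ (x, l) ≥ 1/2}`. -/
def weightedMedian {d : ℕ} (K : Measure (Space d)) (φ : Space d → ℝ) (x : Space d) : ℝ :=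
  sSup {l : ℝ | 1 / 2 ≤ superlevelMass K φ x l}

/-- One step of size `k` of the median filter scheme `φ^{n+1} = M_{K_{√(2k)}} φ^n`. -/
def medianStep {d : ℕ} (K : Measure (Space d)) (k : ℝ) (φ : Space d → ℝ) : Space d → ℝ :=
  weightedMedian (scaledKernel K (Real.sqrt (2 * k))) φ

/-- The scheme is consistent of order `p` in time with `u_t = c |∇u| ∇ · (∇u / |∇u|)`: for
smooth bounded initial data, near a point with nonvanishing gradient, one step of size `k` of the
scheme differs from the exact smooth evolution at time `k` by `O(k^{p+1})` as `k → 0+`. -/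
def IsConsistentOfOrder {d : ℕ} (K : Measure (Space d)) (c : ℝ) (p : ℕ) : Prop :=
  ∀ (u : ℝ → Space d → ℝ) (T : ℝ) (U : Set (Space d)) (x : Space d),
    0 < T → IsOpen U → x ∈ U →
    ContDiff ℝ ∞ (u 0) → (∃ C : ℝ, ∀ y, |u 0 y| ≤ C) →
    IsSmoothFlow c u T U →
    (fun k : ℝ => medianStep K k (u 0) x - u k x) =O[𝓝[>] 0] (fun k : ℝ => k ^ (p + 1))

/-! ### Radial moments and expansion coefficients of a kernel on `ℝ^3` -/

/-- `⟨K⟩_n = ∫_0^∞ r^n K(r) dr` for a radial profile `K`. -/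
def radialMoment (κ : ℝ → ℝ) (n : ℕ) : ℝ := ∫ r in Ioi (0 : ℝ), r ^ n * κ r

/-- `B_0 = ⟨K⟩_3 / (4 ⟨K⟩_1)`. -/
def coeffB0 (κ : ℝ → ℝ) : ℝ := radialMoment κ 3 / (4 * radialMoment κ 1)

/-- `B_1 = (1/64) ⟨K⟩_5 / ⟨K⟩_1`. -/
def coeffB1 (κ : ℝ → ℝ) : ℝ := 1 / 64 * (radialMoment κ 5 / radialMoment κ 1)

/-- `B_2 = -((5/128) ⟨K⟩_5 / ⟨K⟩_1 - (1/32) ⟨K⟩_3^2 / ⟨K⟩_1^2)`. -/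
def coeffB2 (κ : ℝ → ℝ) : ℝ :=
  -(5 / 128 * (radialMoment κ 5 / radialMoment κ 1)
    - 1 / 32 * (radialMoment κ 3 ^ 2 / radialMoment κ 1 ^ 2))

/-- `B_3 = (3/32) ⟨K⟩_5 / ⟨K⟩_1 - (1/16) ⟨K⟩_3^2 / ⟨K⟩_1^2`. -/
def coeffB3 (κ : ℝ → ℝ) : ℝ :=
  3 / 32 * (radialMoment κ 5 / radialMoment κ 1)
    - 1 / 16 * (radialMoment κ 3 ^ 2 / radialMoment κ 1 ^ 2)

end MedianFilter

end

/-!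
Everything is tested on one family of exact flows, the shrinking cylinders
`u(t, y) = exp(-(y i ^ 2 + y j ^ 2) - 2 c t)` with `i ≠ j`, at a point where the radius is one
(`isSmoothFlow_cylinderFlow`, `IsConsistentOfOrder.cylinder`). The initial datum does not depend on
`c`, so first order consistency determines the speed (`IsConsistentOfOrder.speed_unique`), and both
statements about schemes follow once second order consistency with speed `c` is shown to force
`c = 0` (`IsConsistentOfOrder.speed_eq_zero`).

With `√(2 k) = 2 ε`, second order consistency says that the set
`{z | ε (z i ^ 2 + z j ^ 2) - z i ≤ b ε}` has mass at least, respectively at most, one half when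
`b = c + C ε ^ 4`, respectively `b = c - C ε ^ 4`
(`exists_mass_bounds_of_isConsistentOfOrder_two`). The set involves two coordinates only, so `K` may
be replaced by its marginal on three coordinates. Only the radial symmetry of the characteristic
function is needed there, and that passes to marginals (`charFun_map_castAdd_eq`). A radial
probability measure on `ℝ^3` is the law of `ρ (t, √(1 - t²) cos α, √(1 - t²) sin α)` with `t` uniform
on `(-1, 1)`, `α` uniform and both independent of `ρ`
(`eq_map_norm_smul_sphericalPoint`, which contains Archimedes' theorem on the sphere). In these
variables, with `a = cos² α`, the set is `t ≥ ε (ρ a - b / ρ) + ε ρ (1 - a) t²`, so that the mass `p`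
of a slice at fixed `ρ, α` satisfies

`1 - 2 p ≈ ε D + ε³ ρ (1 - a) D²`, where `D = ρ a - b / ρ`.

The signs in this expansion decide the matter. The set cannot have mass one half for negative `b`,
hence `0 ≤ c`. If `0 < c`, Fatou's lemma applied to the first order part of the lower mass bound
shows that `1 / ρ` is integrable and that `D` has nonnegative mean (`first_order_condition`), and
Fatou's lemma applied to the third order part of the upper mass bound then shows that the mean of
`ρ (1 - a) D²` is not positive (`second_order_condition`). So `D` vanishes for almost every longitude
`α` with `a ≠ 1`, which is impossible since `a` varies while `ρ` and `c` do not.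

The one-sided estimates are what makes this work for arbitrary radial measures: neither a density
nor any bound on the kernel near the origin is available, and the third order term is bounded below
only after the first order term has been split off.
-/

namespace MedianFilter

/-! ### Radial measures -/

section Radial

variable {E : Type*} [NormedAddCommGroup E] [InnerProductSpace ℝ E] [FiniteDimensional ℝ E]
  [MeasurableSpace E] [BorelSpace E]

theorem charFun_eq_of_norm_eq {μ : Measure E} (h : ∀ A : E ≃ₗᵢ[ℝ] E, μ.map A = μ) {ξ ξ' : E}
    (hξ : ‖ξ‖ = ‖ξ'‖) : charFun μ ξ = charFun μ ξ' := by
  set A : E ≃ₗᵢ[ℝ] E := (ℝ ∙ (ξ - ξ'))ᗮ.reflection with hA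
  have hAξ : A ξ = ξ' := Submodule.reflection_sub hξ
  rw [← hAξ]
  conv_rhs => rw [← h A]
  rw [charFun_apply, charFun_apply, integral_map (by fun_prop) (by fun_prop)]
  simp only [LinearIsometryEquiv.inner_map_map]

/-- A measure whose characteristic function is radial is the law of `‖z‖ w`, where `z` has law `μ`
and `w` is an independent random unit vector with radial characteristic function. Swapping the
roles of `‖z‖ ξ` and `‖ξ‖ z`, which have the same norm, identifies the characteristic functions. -/
theorem eq_map_norm_smul {μ η : Measure E} [IsFiniteMeasure μ] [IsProbabilityMeasure η]
    (hμ : ∀ ξ ξ' : E, ‖ξ‖ = ‖ξ'‖ → charFun μ ξ = charFun μ ξ')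
    (hη : ∀ ξ ξ' : E, ‖ξ‖ = ‖ξ'‖ → charFun η ξ = charFun η ξ')
    (hη1 : ∀ᵐ w ∂η, ‖w‖ = 1) :
    μ = (μ.prod η).map (fun p => ‖p.1‖ • p.2) := by
  apply Measure.ext_of_charFun
  funext ξ
  have hint : ∀ f : E × E → ℝ, Continuous f →
      Integrable (fun p => Complex.exp (f p * Complex.I)) (μ.prod η) := by
    intro f hf
    refine Integrable.of_bound (C := 1) (by fun_prop) (Eventually.of_forall fun p => ?_)
    rw [Complex.norm_exp_ofReal_mul_I]
  symm
  calc charFun ((μ.prod η).map (fun p => ‖p.1‖ • p.2)) ξ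
      = ∫ z, ∫ w, Complex.exp (inner ℝ (‖z‖ • w) ξ * Complex.I) ∂η ∂μ := by
        rw [charFun_apply, integral_map (by fun_prop) (by fun_prop),
          integral_prod _ (hint (fun p => inner ℝ (‖p.1‖ • p.2) ξ) (by fun_prop))]
    _ = ∫ z, charFun η (‖z‖ • ξ) ∂μ := by
        simp only [charFun_apply, inner_smul_left, inner_smul_right, conj_trivial]
    _ = ∫ z, charFun η (‖ξ‖ • z) ∂μ := by
        congr 1
        funext z
        exact hη _ _ (by simp [norm_smul, mul_comm])
    _ = ∫ z, ∫ w, Complex.exp ((‖ξ‖ * inner ℝ w z : ℝ) * Complex.I) ∂η ∂μ := by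
        simp only [charFun_apply, inner_smul_right]
    _ = ∫ w, ∫ z, Complex.exp ((‖ξ‖ * inner ℝ w z : ℝ) * Complex.I) ∂μ ∂η :=
        integral_integral_swap (hint (fun p => ‖ξ‖ * inner ℝ p.2 p.1) (by fun_prop))
    _ = ∫ w, charFun μ (‖ξ‖ • w) ∂η := by
        simp only [charFun_apply, inner_smul_right, real_inner_comm]
    _ = ∫ w, charFun μ ξ ∂η := by
        refine integral_congr_ae ?_
        filter_upwards [hη1] with w hw
        exact hμ _ _ (by simp [norm_smul, hw])
    _ = charFun μ ξ := by simp

end Radial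

open scoped ENNReal
open Real (cos sin)

/-! ### Spherical coordinates and the uniform measure on the sphere of `ℝ^3` -/

theorem lintegral_space_three {g : Space 3 → ℝ≥0∞} (hg : Measurable g) :
    ∫⁻ x, g x = ∫⁻ a : ℝ, ∫⁻ q : ℝ × ℝ, g !₂[a, q.1, q.2] := by
  have h1 := (PiLp.volume_preserving_toLp (Fin 3)).lintegral_comp hg
  have h2 := ((volume_preserving_piFinSuccAbove (fun _ : Fin 3 => ℝ) 0).symm).lintegral_comp
    (f := fun v : Fin 3 → ℝ => g (WithLp.toLp 2 v)) (by fun_prop)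
  have h3 := fun a : ℝ => ((volume_preserving_finTwoArrow ℝ).symm).lintegral_comp
    (f := fun v : Fin 2 → ℝ => g (WithLp.toLp 2 (Fin.cons a v : Fin 3 → ℝ))) (by
      refine hg.comp ((WithLp.measurable_toLp 2 _).comp ?_)
      refine measurable_pi_lambda _ fun i => ?_
      refine Fin.cases ?_ (fun j => ?_) i
      · simp
      · simpa using measurable_pi_apply j)
  rw [← h1, ← h2, Measure.volume_eq_prod, lintegral_prod _ (by
    refine Measurable.aemeasurable ?_
    exact hg.comp ((WithLp.measurable_toLp 2 _).comp (MeasurableEquiv.measurable _)))]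
  refine lintegral_congr fun a => ?_
  have hcons : ∀ v : Fin 2 → ℝ, (MeasurableEquiv.piFinSuccAbove (fun _ : Fin 3 => ℝ) 0).symm (a, v)
      = Fin.cons a v := fun v => by
    funext i
    fin_cases i <;> rfl
  have hvec : ∀ q : ℝ × ℝ, (Fin.cons a (MeasurableEquiv.finTwoArrow.symm q) : Fin 3 → ℝ)
      = ![a, q.1, q.2] := fun q => by
    funext i
    fin_cases i <;> rfl
  simp only [hcons, ← h3 a, hvec]

/-- Integration in spherical coordinates, the polar axis being the first coordinate axis. -/
theorem lintegral_spherical {g : Space 3 → ℝ≥0∞} (hg : Measurable g) :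
    ∫⁻ x, g x = ∫⁻ α in Ioo (-Real.pi) Real.pi, ∫⁻ θ in Ioo 0 Real.pi, ∫⁻ R in Ioi (0 : ℝ),
      ENNReal.ofReal (R ^ 2 * sin θ) *
        g !₂[R * cos θ, R * sin θ * cos α, R * sin θ * sin α] := by
  have hvec : ∀ {X : Type} [MeasurableSpace X] {a b c : X → ℝ}, Measurable a → Measurable b →
      Measurable c → Measurable fun x => g !₂[a x, b x, c x] := by
    intro X _ a b c ha hb hc
    refine hg.comp ((WithLp.measurable_toLp 2 _).comp (measurable_pi_lambda _ fun i => ?_))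
    fin_cases i <;> simpa
  rw [lintegral_space_three hg]
  -- polar coordinates in the plane of the last two variables
  have h1 : ∀ a : ℝ, ∫⁻ q : ℝ × ℝ, g !₂[a, q.1, q.2] = ∫⁻ α in Ioo (-Real.pi) Real.pi,
      ∫⁻ r in Ioi (0 : ℝ), ENNReal.ofReal r * g !₂[a, r * cos α, r * sin α] := by
    intro a
    rw [← lintegral_comp_polarCoord_symm, polarCoord_target, Measure.volume_eq_prod,
      ← Measure.prod_restrict, lintegral_prod_symm]
    · simp only [polarCoord_symm_apply, smul_eq_mul]
    · simp only [polarCoord_symm_apply, smul_eq_mul]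
      refine Measurable.aemeasurable (Measurable.mul (by fun_prop) (hvec ?_ ?_ ?_)) <;> fun_prop
  simp only [h1]
  rw [lintegral_lintegral_swap]
  · refine lintegral_congr fun α => ?_
    -- polar coordinates in the half-plane of the first variable and the distance to the axis
    set G : ℝ × ℝ → ℝ≥0∞ := fun p => (Ioi (0 : ℝ)).indicator (fun r => ENNReal.ofReal r *
      g !₂[p.1, r * cos α, r * sin α]) p.2 with hG
    have hGm : Measurable G := by
      have : G = (Prod.snd ⁻¹' Ioi (0 : ℝ)).indicator (fun p : ℝ × ℝ => ENNReal.ofReal p.2 *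
          g !₂[p.1, p.2 * cos α, p.2 * sin α]) := by
        funext p
        simp [hG, indicator]
      rw [this]
      refine Measurable.indicator (Measurable.mul (by fun_prop) (hvec ?_ ?_ ?_))
        (measurable_snd measurableSet_Ioi) <;> fun_prop
    have h2 : ∀ a : ℝ, ∫⁻ r in Ioi (0 : ℝ), ENNReal.ofReal r * g !₂[a, r * cos α, r * sin α] =
        ∫⁻ r, G (a, r) := fun a => by
      rw [← lintegral_indicator measurableSet_Ioi]
    simp only [h2]
    rw [← lintegral_prod _ hGm.aemeasurable, ← Measure.volume_eq_prod,
      ← lintegral_comp_polarCoord_symm, polarCoord_target, Measure.volume_eq_prod,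
      ← Measure.prod_restrict, lintegral_prod_symm]
    · have hsub : Ioo 0 Real.pi ⊆ Ioo (-Real.pi) Real.pi :=
        Ioo_subset_Ioo_left (by linarith [Real.pi_pos])
      rw [← lintegral_indicator measurableSet_Ioo, ← lintegral_indicator measurableSet_Ioo]
      refine lintegral_congr fun θ => ?_
      by_cases hθ : θ ∈ Ioo 0 Real.pi
      · rw [indicator_of_mem hθ, indicator_of_mem (hsub hθ)]
        refine setLIntegral_congr_fun measurableSet_Ioi fun R hR => ?_
        have hR : 0 < R := hR
        have hs : 0 < sin θ := Real.sin_pos_of_mem_Ioo hθ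
        have : R * sin θ ∈ Ioi (0 : ℝ) := mul_pos hR hs
        simp only [polarCoord_symm_apply, hG, indicator_of_mem this, smul_eq_mul]
        rw [← mul_assoc, ← ENNReal.ofReal_mul hR.le]
        congr 2
        ring
      · rw [indicator_of_notMem hθ]
        by_cases hθ' : θ ∈ Ioo (-Real.pi) Real.pi
        · rw [indicator_of_mem hθ']
          have hs : sin θ ≤ 0 := by
            refine Real.sin_nonpos_of_nonpos_of_neg_pi_le ?_ hθ'.1.le
            by_contra hcon
            exact hθ ⟨not_le.1 hcon, hθ'.2⟩
          rw [setLIntegral_congr_fun (g := fun _ => 0) measurableSet_Ioi, lintegral_zero]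
          intro R hR
          have hR : 0 < R := hR
          have : R * sin θ ∉ Ioi (0 : ℝ) := by
            simp only [mem_Ioi, not_lt]
            exact mul_nonpos_of_nonneg_of_nonpos hR.le hs
          simp [polarCoord_symm_apply, hG, indicator_of_notMem this]
        · rw [indicator_of_notMem hθ']
    · simp only [polarCoord_symm_apply, smul_eq_mul]
      exact Measurable.aemeasurable (Measurable.mul (by fun_prop) (hGm.comp (by fun_prop)))
  · refine Measurable.aemeasurable ?_
    refine Measurable.lintegral_prod_right' (f := fun p : (ℝ × ℝ) × ℝ => ENNReal.ofReal p.2 *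
      g !₂[p.1.1, p.2 * cos p.1.2, p.2 * sin p.1.2]) ?_
    refine Measurable.mul (by fun_prop) (hvec ?_ ?_ ?_) <;> fun_prop

/-- The substitution `t = cos θ`. -/
theorem lintegral_sin_mul_comp_cos (h : ℝ → ℝ → ℝ≥0∞) :
    ∫⁻ θ in Ioo 0 Real.pi, ENNReal.ofReal (sin θ) * h (cos θ) (sin θ) =
      ∫⁻ t in Ioo (-1 : ℝ) 1, h t √(1 - t ^ 2) := by
  have himg : cos '' Ioo 0 Real.pi = Ioo (-1 : ℝ) 1 := by
    ext t
    constructor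
    · rintro ⟨θ, hθ, rfl⟩
      have := Real.sin_pos_of_mem_Ioo hθ
      have := Real.sin_sq_add_cos_sq θ
      constructor <;> nlinarith
    · rintro ⟨h1, h2⟩
      exact ⟨Real.arccos t, ⟨Real.arccos_pos.2 h2, Real.arccos_lt_pi.2 h1⟩,
        Real.cos_arccos h1.le h2.le⟩
  rw [← himg, lintegral_image_eq_lintegral_abs_deriv_mul measurableSet_Ioo
    (fun x _ => (Real.hasDerivAt_cos x).hasDerivWithinAt)
    (Real.injOn_cos.mono Ioo_subset_Icc_self)]
  refine setLIntegral_congr_fun measurableSet_Ioo fun θ hθ => ?_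
  have := Real.sin_pos_of_mem_Ioo hθ
  simp only [abs_neg, abs_of_pos this]
  rw [← Real.abs_sin_eq_sqrt_one_sub_cos_sq, abs_of_pos this]

/-- The unit vector of height `t` above the equatorial plane and longitude `α`. -/
noncomputable def sphericalPoint (p : ℝ × ℝ) : Space 3 :=
  !₂[p.1, √(1 - p.1 ^ 2) * cos p.2, √(1 - p.1 ^ 2) * sin p.2]

theorem measurable_sphericalPoint : Measurable sphericalPoint := by
  refine (WithLp.measurable_toLp 2 _).comp (measurable_pi_lambda _ fun i => ?_)
  fin_cases i <;> simp <;> fun_prop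

theorem norm_sphericalPoint {p : ℝ × ℝ} (hp : p.1 ∈ Ioo (-1 : ℝ) 1) : ‖sphericalPoint p‖ = 1 := by
  have h0 : 0 ≤ 1 - p.1 ^ 2 := by nlinarith [hp.1, hp.2]
  rw [sphericalPoint, EuclideanSpace.norm_eq, Real.sqrt_eq_one, Fin.sum_univ_three]
  simp only [Real.norm_eq_abs, sq_abs]
  simp only [Matrix.cons_val_zero, Matrix.cons_val_one, Matrix.cons_val]
  rw [mul_pow, mul_pow, Real.sq_sqrt h0]
  linear_combination (1 - p.1 ^ 2) * Real.sin_sq_add_cos_sq p.2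

/-- The uniform distribution of a height in `(-1, 1)`. -/
noncomputable def heightMeasure : Measure ℝ := ProbabilityTheory.cond volume (Ioo (-1) 1)

/-- The uniform distribution of a longitude in `(-π, π)`. -/
noncomputable def angleMeasure : Measure ℝ :=
  ProbabilityTheory.cond volume (Ioo (-Real.pi) Real.pi)

instance : IsProbabilityMeasure heightMeasure :=
  ProbabilityTheory.cond_isProbabilityMeasure_of_finite (by simp) (by simp)

instance : IsProbabilityMeasure angleMeasure :=
  ProbabilityTheory.cond_isProbabilityMeasure_of_finite
    (by simp [Real.pi_pos]) (by simp)

/-- The uniform probability measure on the unit sphere of `ℝ^3`, built from a uniform height and an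
independent uniform longitude. -/
noncomputable def sphereMeasure : Measure (Space 3) :=
  (heightMeasure.prod angleMeasure).map sphericalPoint

instance : IsProbabilityMeasure sphereMeasure :=
  Measure.isProbabilityMeasure_map measurable_sphericalPoint.aemeasurable

theorem ae_heightMeasure : ∀ᵐ t ∂heightMeasure, t ∈ Ioo (-1 : ℝ) 1 :=
  ProbabilityTheory.ae_cond_mem measurableSet_Ioo

theorem norm_eq_one_sphereMeasure : ∀ᵐ w ∂sphereMeasure, ‖w‖ = 1 := by
  rw [sphereMeasure, ae_map_iff measurable_sphericalPoint.aemeasurable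
    (measurableSet_eq_fun measurable_norm measurable_const)]
  filter_upwards [Measure.quasiMeasurePreserving_fst.ae ae_heightMeasure] with p hp
  exact norm_sphericalPoint hp

/-- Radial projection of Lebesgue measure on the unit ball onto the sphere: this is where
Archimedes' theorem, that the height of a uniform point on the sphere is uniform, enters. -/
theorem exists_volume_cone_eq : ∃ D : ℝ≥0∞, D ≠ 0 ∧ D ≠ ⊤ ∧ ∀ S : Set (Space 3),
    MeasurableSet S → volume {x : Space 3 | ‖x‖ < 1 ∧ ‖x‖⁻¹ • x ∈ S} = D * sphereMeasure S := by
  set V : ℝ≥0∞ := ∫⁻ R in Ioi (0 : ℝ), (Iio 1).indicator (fun R => ENNReal.ofReal (R ^ 2)) R with hV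
  set m : ℝ≥0∞ := volume (Ioo (-1 : ℝ) 1) with hm
  set l : ℝ≥0∞ := volume (Ioo (-Real.pi) Real.pi) with hl
  have hm0 : m ≠ 0 := by simp [hm]
  have hmt : m ≠ ⊤ := by simp [hm]
  have hl0 : l ≠ 0 := by simp [hl, Real.pi_pos]
  have hlt : l ≠ ⊤ := by simp [hl]
  have hV' : V = ∫⁻ R in Ioo (0 : ℝ) 1, ENNReal.ofReal (R ^ 2) := by
    rw [hV, ← lintegral_indicator measurableSet_Ioi, ← lintegral_indicator measurableSet_Ioo]
    refine lintegral_congr fun R => ?_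
    rw [← Ioi_inter_Iio, ← indicator_indicator]
  have hV0 : V ≠ 0 := by
    rw [hV', Ne, setLIntegral_eq_zero_iff measurableSet_Ioo (by fun_prop)]
    intro h
    have : volume (Ioo (0 : ℝ) 1) = 0 := by
      rw [← nonpos_iff_eq_zero, ← ae_iff.1 h]
      refine measure_mono fun R hR => ?_
      simp only [mem_ofPred_eq, not_forall]
      refine ⟨hR, ?_⟩
      have : 0 < R := hR.1
      simp only [ENNReal.ofReal_eq_zero, not_le]
      positivity
    simp at this
  have hVt : V ≠ ⊤ := by
    refine ne_top_of_le_ne_top (b := ∫⁻ R in Ioo (0 : ℝ) 1, 1) (by simp) ?_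
    rw [hV']
    refine setLIntegral_mono (by fun_prop) fun R hR => ?_
    rw [ENNReal.ofReal_le_one]
    nlinarith [hR.1, hR.2]
  refine ⟨V * m * l, by simp [hV0, hm0, hl0], by finiteness, fun S hS => ?_⟩
  set F : Space 3 → ℝ≥0∞ := S.indicator 1 with hF
  have hFm : Measurable F := measurable_one.indicator hS
  have hT : MeasurableSet {x : Space 3 | ‖x‖ < 1 ∧ ‖x‖⁻¹ • x ∈ S} :=
    (measurableSet_lt measurable_norm measurable_const).inter
      ((by fun_prop : Measurable fun x : Space 3 => ‖x‖⁻¹ • x) hS)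
  have hleft : volume {x : Space 3 | ‖x‖ < 1 ∧ ‖x‖⁻¹ • x ∈ S} =
      ∫⁻ α in Ioo (-Real.pi) Real.pi, ∫⁻ t in Ioo (-1 : ℝ) 1, V * F (sphericalPoint (t, α)) := by
    rw [← lintegral_indicator_one hT, lintegral_spherical (measurable_one.indicator hT)]
    refine lintegral_congr fun α => ?_
    refine Eq.trans ?_ (lintegral_sin_mul_comp_cos
      (fun t s => V * F !₂[t, s * cos α, s * sin α]))
    refine setLIntegral_congr_fun measurableSet_Ioo fun θ hθ => ?_
    have hs := Real.sin_pos_of_mem_Ioo hθ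
    set w : Space 3 := !₂[cos θ, sin θ * cos α, sin θ * sin α] with hw
    have hw1 : ‖w‖ = 1 := by
      rw [hw, EuclideanSpace.norm_eq, Real.sqrt_eq_one, Fin.sum_univ_three]
      simp only [Real.norm_eq_abs, sq_abs]
      simp only [Matrix.cons_val_zero, Matrix.cons_val_one, Matrix.cons_val]
      linear_combination (sin θ) ^ 2 * Real.sin_sq_add_cos_sq α + Real.sin_sq_add_cos_sq θ
    have hRw : ∀ R : ℝ, !₂[R * cos θ, R * sin θ * cos α, R * sin θ * sin α] = R • w := by
      intro R
      ext i
      fin_cases i <;> simp [hw, mul_assoc]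
    calc _ = ∫⁻ R in Ioi (0 : ℝ), (Iio 1).indicator (fun R => ENNReal.ofReal (R ^ 2)) R *
          (ENNReal.ofReal (sin θ) * F w) := by
          refine setLIntegral_congr_fun measurableSet_Ioi fun R hR => ?_
          have hR : 0 < R := hR
          simp only [hRw]
          have hn : ‖R • w‖ = R := by rw [norm_smul, hw1, mul_one, Real.norm_of_nonneg hR.le]
          by_cases h1 : R < 1
          · rw [indicator_of_mem (show R ∈ Iio 1 from h1), ENNReal.ofReal_mul (by positivity),
              mul_assoc]
            congr 2
            have hmem : R • w ∈ {x : Space 3 | ‖x‖ < 1 ∧ ‖x‖⁻¹ • x ∈ S} ↔ w ∈ S := by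
              rw [mem_ofPred_eq, hn, smul_smul, inv_mul_cancel₀ hR.ne', one_smul]
              exact and_iff_right h1
            by_cases hwS : w ∈ S
            · rw [indicator_of_mem (hmem.2 hwS), hF, indicator_of_mem hwS]
              rfl
            · rw [indicator_of_notMem (hmem.not.2 hwS), hF, indicator_of_notMem hwS]
          · rw [indicator_of_notMem (show R ∉ Iio 1 from h1), indicator_of_notMem (by
              simp [hn, h1])]
            simp
      _ = V * (ENNReal.ofReal (sin θ) * F w) := by
          rw [lintegral_mul_const]
          exact Measurable.indicator (by fun_prop) measurableSet_Iio
      _ = _ := by ring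
  have hprod : ∀ h : ℝ × ℝ → ℝ≥0∞, Measurable h →
      ∫⁻ α in Ioo (-Real.pi) Real.pi, ∫⁻ t in Ioo (-1 : ℝ) 1, h (t, α) =
        m * l * ∫⁻ p, h p ∂(heightMeasure.prod angleMeasure) := by
    intro h hh
    rw [lintegral_prod_symm _ hh.aemeasurable, angleMeasure, heightMeasure, ProbabilityTheory.cond,
      ProbabilityTheory.cond, lintegral_smul_measure]
    simp only [lintegral_smul_measure, smul_eq_mul]
    rw [lintegral_const_mul _ (hh.lintegral_prod_left'), ← hm, ← hl]
    rw [show ∀ I : ℝ≥0∞, m * l * (l⁻¹ * (m⁻¹ * I)) = (m * m⁻¹) * (l * l⁻¹) * I from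
      fun I => by ring, ENNReal.mul_inv_cancel hm0 hmt, ENNReal.mul_inv_cancel hl0 hlt]
    simp
  have hFs : Measurable fun p => F (sphericalPoint p) := hFm.comp measurable_sphericalPoint
  rw [hleft, hprod (fun p => V * F (sphericalPoint p)) (hFs.const_mul V), lintegral_const_mul _ hFs,
    ← lintegral_map hFm measurable_sphericalPoint, ← sphereMeasure, hF, lintegral_indicator_one hS]
  ring

theorem map_sphereMeasure (A : Space 3 ≃ₗᵢ[ℝ] Space 3) : sphereMeasure.map A = sphereMeasure := by
  obtain ⟨D, hD0, hDt, hD⟩ := exists_volume_cone_eq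
  ext S hS
  have hA : Measurable A := A.continuous.measurable
  rw [Measure.map_apply hA hS]
  refine (ENNReal.mul_right_inj hD0 hDt).1 ?_
  have hT : MeasurableSet {x : Space 3 | ‖x‖ < 1 ∧ ‖x‖⁻¹ • x ∈ S} :=
    (measurableSet_lt measurable_norm measurable_const).inter
      ((by fun_prop : Measurable fun x : Space 3 => ‖x‖⁻¹ • x) hS)
  rw [← hD S hS, ← hD _ (hA hS), ← A.measurePreserving.measure_preimage hT.nullMeasurableSet]
  congr 1
  ext x
  simp

/-- A finite measure on `ℝ^3` with radial characteristic function is the law of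
`‖z‖ (t, √(1 - t²) cos α, √(1 - t²) sin α)` with independent `z`, `t`, `α`, the last two being
uniform. -/
theorem eq_map_norm_smul_sphericalPoint {μ : Measure (Space 3)} [IsFiniteMeasure μ]
    (hμ : ∀ ξ ξ' : Space 3, ‖ξ‖ = ‖ξ'‖ → charFun μ ξ = charFun μ ξ') :
    μ = (μ.prod (heightMeasure.prod angleMeasure)).map
      (fun p => ‖p.1‖ • sphericalPoint p.2) := by
  have h := eq_map_norm_smul hμ (fun ξ ξ' => charFun_eq_of_norm_eq map_sphereMeasure)
    norm_eq_one_sphereMeasure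
  have h2 : μ.prod sphereMeasure = (μ.prod (heightMeasure.prod angleMeasure)).map
      (Prod.map id sphericalPoint) := by
    rw [← Measure.map_prod_map _ _ measurable_id measurable_sphericalPoint, Measure.map_id,
      sphereMeasure]
  conv_lhs => rw [h, h2]
  rw [Measure.map_map (by fun_prop) (measurable_id.prodMap measurable_sphericalPoint)]
  rfl

/-! ### Slices of the sublevel set of the median filter on a sphere -/

/-- The relative length of the set of heights `t` at which the point `z = ρ (t, √(1 - t²) cos α, ·)`
with `a = cos² α` satisfies `ε (z₀² + z₁²) - z₀ ≤ c ε`. -/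
noncomputable def sliceMass (ε c ρ a : ℝ) : ℝ :=
  heightMeasure.real {t | ε * (ρ ^ 2 * (t ^ 2 + (1 - t ^ 2) * a)) - ρ * t ≤ c * ε}

theorem measurable_sliceMass (ε c : ℝ) :
    Measurable fun p : ℝ × ℝ => sliceMass ε c p.1 p.2 := by
  refine Measurable.ennreal_toReal (measurable_measure_prodMk_left (s := {q : (ℝ × ℝ) × ℝ |
    ε * (q.1.1 ^ 2 * (q.2 ^ 2 + (1 - q.2 ^ 2) * q.1.2)) - q.1.1 * q.2 ≤ c * ε}) ?_)
  exact measurableSet_le (by fun_prop) (by fun_prop)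

theorem sliceMass_nonneg (ε c ρ a : ℝ) : 0 ≤ sliceMass ε c ρ a := measureReal_nonneg

theorem sliceMass_le_one (ε c ρ a : ℝ) : sliceMass ε c ρ a ≤ 1 := measureReal_le_one

theorem heightMeasure_real_eq (S : Set ℝ) :
    heightMeasure.real S = 2⁻¹ * volume.real (Ioo (-1) 1 ∩ S) := by
  rw [heightMeasure, measureReal_def, ProbabilityTheory.cond_apply measurableSet_Ioo,
    ENNReal.toReal_mul, ENNReal.toReal_inv, Real.volume_Ioo, ENNReal.toReal_ofReal (by norm_num),
    ← measureReal_def]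
  norm_num

theorem le_one_sub_two_mul_heightMeasure {S : Set ℝ} {L : ℝ} (hL : L ≤ 1)
    (h : ∀ t ∈ Ioo (-1 : ℝ) 1, t ∈ S → L ≤ t) : L ≤ 1 - 2 * heightMeasure.real S := by
  have h1 : volume.real (Ioo (-1) 1 ∩ S) ≤ volume.real (Icc L 1) := by
    refine measureReal_mono (fun t ht => ⟨h t ht.1 ht.2, ht.1.2.le⟩) (by simp)
  rw [measureReal_def (s := Icc L 1), Real.volume_Icc, ENNReal.toReal_ofReal (by linarith)] at h1
  rw [heightMeasure_real_eq]
  linarith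

theorem one_sub_two_mul_heightMeasure_le {S : Set ℝ} {L : ℝ} (hL : -1 ≤ L)
    (h : ∀ t ∈ Ioo (-1 : ℝ) 1, L ≤ t → t ∈ S) : 1 - 2 * heightMeasure.real S ≤ L := by
  have h1 : volume.real (Ioo L 1) ≤ volume.real (Ioo (-1) 1 ∩ S) := by
    refine measureReal_mono (fun t ht => ?_)
      (ne_top_of_le_ne_top (b := volume (Ioo (-1 : ℝ) 1)) (by simp) (measure_mono inter_subset_left))
    have : t ∈ Ioo (-1 : ℝ) 1 := ⟨hL.trans_lt ht.1, ht.2⟩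
    exact ⟨this, h t this ht.1.le⟩
  rw [measureReal_def (s := Ioo L 1), Real.volume_Ioo] at h1
  have h2 : 1 - L ≤ (ENNReal.ofReal (1 - L)).toReal := by
    rw [ENNReal.toReal_ofReal']
    exact le_max_left _ _
  rw [heightMeasure_real_eq]
  linarith

/-- On a sphere of radius `ρ > 0` the sublevel set lies above a parabola in the height `t`. The
second order term `ε ρ (1 - a) t²` has a sign, which drives all one-sided estimates below. -/
theorem slice_mem_iff {ε c ρ a t : ℝ} (hρ : 0 < ρ) :
    ε * (ρ ^ 2 * (t ^ 2 + (1 - t ^ 2) * a)) - ρ * t ≤ c * ε ↔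
      ε * (ρ * a - c / ρ) + ε * (ρ * (1 - a)) * t ^ 2 ≤ t := by
  have h : ρ * (ε * (ρ * a - c / ρ) + ε * (ρ * (1 - a)) * t ^ 2) =
      ε * (ρ ^ 2 * (t ^ 2 + (1 - t ^ 2) * a)) - c * ε := by
    field_simp
    ring
  rw [← mul_le_mul_iff_right₀ hρ (b := ε * (ρ * a - c / ρ) + _), h]
  constructor <;> intro h' <;> linarith

theorem one_sub_two_mul_sliceMass_le {ε c ρ a : ℝ} (hε : 0 < ε) (hc : 0 ≤ c) (hρ : 0 ≤ ρ)
    (ha1 : a ≤ 1) : 1 - 2 * sliceMass ε c ρ a ≤ ε * ρ := by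
  refine one_sub_two_mul_heightMeasure_le (by nlinarith) fun t ht hL => ?_
  have h1 : t ^ 2 + (1 - t ^ 2) * a ≤ 1 := by
    have h0 : 0 ≤ 1 - t ^ 2 := by nlinarith [ht.1, ht.2]
    nlinarith [mul_nonneg h0 (sub_nonneg.2 ha1)]
  have h2 := mul_le_mul_of_nonneg_left h1 (by positivity : 0 ≤ ε * ρ ^ 2)
  have h3 := mul_le_mul_of_nonneg_left hL hρ
  have h4 := mul_nonneg hc hε.le
  rw [mem_ofPred_eq]
  nlinarith

/-- At `ρ = 0` the inequality `0 ≤ c ε` holds for all `t`; the atom then counts fully. -/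
theorem sliceMass_zero {ε c : ℝ} (hε : 0 < ε) (hc : 0 ≤ c) (a : ℝ) : sliceMass ε c 0 a = 1 := by
  have : {t : ℝ | ε * (0 ^ 2 * (t ^ 2 + (1 - t ^ 2) * a)) - 0 * t ≤ c * ε} = univ := by
    refine eq_univ_of_forall fun t => ?_
    rw [mem_ofPred_eq]
    nlinarith [mul_nonneg hc hε.le]
  rw [sliceMass, this]
  simp

theorem sliceMass_lt_half {ε c ρ a : ℝ} (hε : 0 < ε) (hc : c < 0) (hρ : 0 ≤ ρ) (ha0 : 0 ≤ a)
    (ha1 : a ≤ 1) : 0 < 1 - 2 * sliceMass ε c ρ a := by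
  rcases hρ.eq_or_lt with rfl | hρ
  · have h := le_one_sub_two_mul_heightMeasure (L := 1)
      (S := {t : ℝ | ε * (0 ^ 2 * (t ^ 2 + (1 - t ^ 2) * a)) - 0 * t ≤ c * ε}) le_rfl (by
        intro t _ ht
        rw [mem_ofPred_eq] at ht
        nlinarith [mul_neg_of_neg_of_pos hc hε])
    rw [sliceMass]
    linarith
  · have hD : 0 < ε * (ρ * a - c / ρ) := by
      have := div_neg_of_neg_of_pos hc hρ
      have := mul_nonneg hρ.le ha0
      exact mul_pos hε (by linarith)
    refine (lt_min one_pos hD).trans_le (le_one_sub_two_mul_heightMeasure (min_le_left _ _) ?_)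
    intro t _ ht
    rw [mem_ofPred_eq, slice_mem_iff hρ] at ht
    have h2 : 0 ≤ ε * (ρ * (1 - a)) * t ^ 2 := by
      have : 0 ≤ 1 - a := by linarith
      positivity
    exact (min_le_right _ _).trans (by linarith)

/-- A lower bound for the deficit `1 - 2 * sliceMass` on all spheres. The cubic loss accounts for
spheres so large that the sublevel set misses them. -/
theorem le_one_sub_two_mul_sliceMass {ε c ρ a : ℝ} (hε : 0 < ε) (hc : 0 ≤ c) (hρ : 0 < ρ)
    (ha1 : a ≤ 1) :
    ε * (ρ * a - c / ρ) - ε ^ 3 * ρ ^ 3 ≤ 1 - 2 * sliceMass ε c ρ a := by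
  have hcρ : 0 ≤ c / ρ := by positivity
  have h1a : 0 ≤ 1 - a := by linarith
  have hx : 0 < ε * ρ := by positivity
  have hcube : 0 < ε ^ 3 * ρ ^ 3 := by positivity
  refine le_one_sub_two_mul_heightMeasure ?_ fun t _ ht => ?_
  · have h1 : ε * (ρ * a - c / ρ) ≤ ε * ρ :=
      mul_le_mul_of_nonneg_left (by nlinarith) hε.le
    rcases le_total (ε * ρ) 1 with h | h
    · linarith
    · have : ε * ρ ≤ (ε * ρ) ^ 3 := le_self_pow₀ h (by norm_num)
      rw [mul_pow] at this
      linarith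
  · rw [mem_ofPred_eq, slice_mem_iff hρ] at ht
    have h2 : 0 ≤ ε * (ρ * (1 - a)) * t ^ 2 := by positivity
    linarith

/-- The first order upper bound for the deficit `1 - 2 * sliceMass` on a sphere of fixed radius. -/
theorem eventually_one_sub_two_mul_sliceMass_le {c C ρ a : ℝ} (hc : 0 < c) (hρ : 0 < ρ)
    (ha1 : a ≤ 1) (ha0 : 0 ≤ a) :
    ∀ᶠ ε in 𝓝[>] (0 : ℝ),
      1 - 2 * sliceMass ε (c - C * ε ^ 4) ρ a ≤ ε * (ρ * a - c / ρ + ε) := by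
  set D := ρ * a - c / ρ with hD
  set M := ρ + |D| + 1 with hM
  have hM0 : 0 < M := by positivity
  have e1 : ∀ᶠ ε in 𝓝 (0 : ℝ), C * ε ^ 3 / ρ + ρ * M ^ 2 * ε < 1 := by
    have : ContinuousAt (fun ε : ℝ => C * ε ^ 3 / ρ + ρ * M ^ 2 * ε) 0 := by fun_prop
    exact this.eventually_lt_const (by simp)
  have e2 : ∀ᶠ ε in 𝓝 (0 : ℝ), -1 < ε * (D + ε) := by
    have : ContinuousAt (fun ε : ℝ => ε * (D + ε)) 0 := by fun_prop
    exact this.eventually_const_lt (by simp)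
  have e4 : ∀ᶠ ε in 𝓝 (0 : ℝ), 0 < c - C * ε ^ 4 := by
    have : ContinuousAt (fun ε : ℝ => c - C * ε ^ 4) 0 := by fun_prop
    exact this.eventually_const_lt (by simpa)
  filter_upwards [self_mem_nhdsWithin, nhdsWithin_le_nhds e1, nhdsWithin_le_nhds e2,
    nhdsWithin_le_nhds e4] with ε hε h1 h2 h4
  have hε : 0 < ε := hε
  refine one_sub_two_mul_heightMeasure_le h2.le fun t ht hL => ?_
  rw [mem_ofPred_eq, slice_mem_iff hρ]
  have h1a : 0 ≤ 1 - a := by linarith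
  have hD' : ρ * a - (c - C * ε ^ 4) / ρ = D + C * ε ^ 4 / ρ := by rw [hD]; ring
  -- Above the height `ε ρ` the point is always in the set; below it, `|t| ≤ ε M` makes the
  -- parabolic term of second order.
  rcases le_total (ε * ρ) t with h | h
  · have hle : (ρ * a - (c - C * ε ^ 4) / ρ) + ρ * (1 - a) * t ^ 2 ≤ ρ := by
      have := div_pos h4 hρ
      have ht1 : t ^ 2 ≤ 1 := by nlinarith [ht.1, ht.2]
      nlinarith [mul_nonneg hρ.le h1a]
    nlinarith
  · have hDM := neg_abs_le D
    have habs : |t| ≤ ε * M := by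
      rw [abs_le]
      constructor
      · refine le_trans ?_ hL
        rw [← mul_neg]
        exact mul_le_mul_of_nonneg_left (by linarith) hε.le
      · exact h.trans (mul_le_mul_of_nonneg_left (by linarith [abs_nonneg D]) hε.le)
    have ht2 : t ^ 2 ≤ ε ^ 2 * M ^ 2 := by
      rw [← mul_pow, ← sq_abs t]
      exact pow_le_pow_left₀ (abs_nonneg t) habs 2
    have h5 : ρ * (1 - a) * t ^ 2 ≤ ρ * (ε ^ 2 * M ^ 2) :=
      mul_le_mul (by nlinarith) ht2 (sq_nonneg t) hρ.le
    have h6 : C * ε ^ 4 / ρ + ρ * (ε ^ 2 * M ^ 2) ≤ ε := by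
      have := mul_le_mul_of_nonneg_left h1.le hε.le
      calc _ = ε * (C * ε ^ 3 / ρ + ρ * M ^ 2 * ε) := by ring
        _ ≤ ε := by linarith
    rw [hD']
    calc _ = ε * (D + C * ε ^ 4 / ρ + ρ * (1 - a) * t ^ 2) := by ring
      _ ≤ ε * (D + ε) := mul_le_mul_of_nonneg_left (by linarith) hε.le
      _ ≤ t := hL

/-- The lower bound for the deficit `1 - 2 * sliceMass` with the third order gain that comes from
the term `ε ρ (1 - a) t²`. -/
theorem eventually_le_one_sub_two_mul_sliceMass {c C ρ a : ℝ} (hρ : 0 < ρ) (ha1 : a ≤ 1) :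
    ∀ᶠ ε in 𝓝[>] (0 : ℝ),
      ε * (ρ * a - (c + C * ε ^ 4) / ρ) +
        ε ^ 3 * (ρ * (1 - a) * (ρ * a - (c + C * ε ^ 4) / ρ) ^ 2 / 2) ≤
      1 - 2 * sliceMass ε (c + C * ε ^ 4) ρ a := by
  set D : ℝ → ℝ := fun ε => ρ * a - (c + C * ε ^ 4) / ρ with hD
  have hDc : Continuous D := by fun_prop
  have h1a : 0 ≤ ρ * (1 - a) := mul_nonneg hρ.le (by linarith)
  have e1 : ∀ᶠ ε in 𝓝 (0 : ℝ), ε * D ε + ε ^ 3 * (ρ * (1 - a) * D ε ^ 2 / 2) < 1 := by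
    have : ContinuousAt (fun ε => ε * D ε + ε ^ 3 * (ρ * (1 - a) * D ε ^ 2 / 2)) 0 := by fun_prop
    exact this.eventually_lt_const (by simp)
  have e2 : ∀ᶠ ε in 𝓝 (0 : ℝ), -(1 / 2) < ε * (ρ * (1 - a)) * (ε * D ε) := by
    have : ContinuousAt (fun ε => ε * (ρ * (1 - a)) * (ε * D ε)) 0 := by fun_prop
    exact this.eventually_const_lt (by simp)
  filter_upwards [self_mem_nhdsWithin, nhdsWithin_le_nhds e1, nhdsWithin_le_nhds e2]
    with ε hε h1 h2
  have hε : 0 < ε := hε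
  refine le_one_sub_two_mul_heightMeasure h1.le fun t ht hS => ?_
  rw [mem_ofPred_eq, slice_mem_iff hρ] at hS
  change ε * D ε + _ ≤ _ at hS
  change ε * D ε + ε ^ 3 * (ρ * (1 - a) * D ε ^ 2 / 2) ≤ t
  set τ := ε * D ε with hτ
  set β := ε * (ρ * (1 - a)) with hβ
  have hβ0 : 0 ≤ β := mul_nonneg hε.le h1a
  have hgain : ε ^ 3 * (ρ * (1 - a) * D ε ^ 2 / 2) = β * τ ^ 2 / 2 := by rw [hτ, hβ]; ring
  rw [hgain]
  -- A height between `τ` and `τ + β τ² / 2` satisfies `t² ≥ τ² / 2`, so it fails `τ + β t² ≤ t`.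
  by_contra! hcon
  have hτt : τ ≤ t := by nlinarith [mul_nonneg hβ0 (sq_nonneg t)]
  have hsq : τ ^ 2 / 2 ≤ t ^ 2 := by
    rcases le_total 0 τ with h | h
    · nlinarith
    · have : t ≤ 3 / 4 * τ := by nlinarith
      nlinarith
  have := mul_le_mul_of_nonneg_left hsq hβ0
  linarith

/-! ### Expansion of the mass of the sublevel set -/

section Average

variable {Ω : Type*} [MeasurableSpace Ω] {Q : Measure Ω} [IsProbabilityMeasure Q] {ρ a : Ω → ℝ}

theorem measurable_sliceMass_comp (hρ : Measurable ρ) (ha : Measurable a) (ε c : ℝ) :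
    Measurable fun x => sliceMass ε c (ρ x) (a x) := by
  have h := (measurable_sliceMass ε c).comp (hρ.prodMk ha)
  simpa only [Function.comp_def] using h

theorem measurable_deficit (hρ : Measurable ρ) (ha : Measurable a) (ε c : ℝ) :
    Measurable fun x => 1 - 2 * sliceMass ε c (ρ x) (a x) :=
  measurable_const.sub ((measurable_sliceMass_comp hρ ha ε c).const_mul 2)

theorem integrable_sliceMass (hρ : Measurable ρ) (ha : Measurable a) (ε c : ℝ) :
    Integrable (fun x => sliceMass ε c (ρ x) (a x)) Q := by
  refine Integrable.of_bound (C := 1)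
    (measurable_sliceMass_comp hρ ha ε c).aestronglyMeasurable
    (Eventually.of_forall fun x => ?_)
  rw [Real.norm_of_nonneg (sliceMass_nonneg _ _ _ _)]
  exact sliceMass_le_one _ _ _ _

theorem integral_deficit (hρ : Measurable ρ) (ha : Measurable a) (ε c : ℝ) :
    ∫ x, (1 - 2 * sliceMass ε c (ρ x) (a x)) ∂Q =
      1 - 2 * ∫ x, sliceMass ε c (ρ x) (a x) ∂Q := by
  rw [integral_sub (integrable_const _) ((integrable_sliceMass hρ ha ε c).const_mul 2),
    integral_const_mul]
  simp

theorem integrable_deficit (hρ : Measurable ρ) (ha : Measurable a) (ε c : ℝ) :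
    Integrable (fun x => 1 - 2 * sliceMass ε c (ρ x) (a x)) Q :=
  (integrable_const _).sub ((integrable_sliceMass hρ ha ε c).const_mul 2)

/-- The median cannot move backwards. -/
theorem nonneg_of_half_le_integral_sliceMass (hρ : Measurable ρ) (ha : Measurable a)
    (hρ0 : ∀ x, 0 ≤ ρ x) (ha0 : ∀ x, 0 ≤ a x) (ha1 : ∀ x, a x ≤ 1) {c C : ℝ}
    (hup : ∀ᶠ ε in 𝓝[>] (0 : ℝ), 1 / 2 ≤ ∫ x, sliceMass ε (c + C * ε ^ 4) (ρ x) (a x) ∂Q) :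
    0 ≤ c := by
  by_contra! hc
  have e1 : ∀ᶠ ε in 𝓝 (0 : ℝ), c + C * ε ^ 4 < 0 := by
    have : ContinuousAt (fun ε : ℝ => c + C * ε ^ 4) 0 := by fun_prop
    exact this.eventually_lt_const (by simpa)
  obtain ⟨ε, h1, h2, hε⟩ :=
    (hup.and ((e1.filter_mono nhdsWithin_le_nhds).and self_mem_nhdsWithin)).exists
  have hpos := fun x => sliceMass_lt_half hε h2 (hρ0 x) (ha0 x) (ha1 x)
  have hI := integral_deficit (Q := Q) hρ ha ε (c + C * ε ^ 4)
  have hI0 : ∫ x, (1 - 2 * sliceMass ε (c + C * ε ^ 4) (ρ x) (a x)) ∂Q = 0 :=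
    le_antisymm (by linarith) (integral_nonneg fun x => (hpos x).le)
  rw [integral_eq_zero_iff_of_nonneg (fun x => (hpos x).le) (integrable_deficit hρ ha _ _)] at hI0
  obtain ⟨x, hx⟩ := hI0.exists
  exact (hpos x).ne' hx

/-- An atom of the kernel at the origin would pin the median. -/
theorem ae_pos_of_integral_sliceMass_le (hρ : Measurable ρ) (ha : Measurable a)
    (hρ0 : ∀ x, 0 ≤ ρ x) (ha1 : ∀ x, a x ≤ 1) (hρi : Integrable ρ Q) {c C : ℝ} (hc : 0 < c)
    (hlow : ∀ᶠ ε in 𝓝[>] (0 : ℝ), ∫ x, sliceMass ε (c - C * ε ^ 4) (ρ x) (a x) ∂Q ≤ 1 / 2) :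
    ∀ᵐ x ∂Q, 0 < ρ x := by
  have hS : MeasurableSet {x | ρ x = 0} := measurableSet_eq_fun hρ measurable_const
  have hSi : Integrable ({x | ρ x = 0}.indicator (1 : Ω → ℝ)) Q :=
    (integrable_const (1 : ℝ)).indicator hS
  have e1 : ∀ᶠ ε in 𝓝 (0 : ℝ), 0 < c - C * ε ^ 4 := by
    have : ContinuousAt (fun ε : ℝ => c - C * ε ^ 4) 0 := by fun_prop
    exact this.eventually_const_lt (by simpa)
  have hle : ∀ᶠ ε in 𝓝[>] (0 : ℝ), Q.real {x | ρ x = 0} ≤ ε * ∫ x, ρ x ∂Q := by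
    filter_upwards [hlow, nhdsWithin_le_nhds e1, self_mem_nhdsWithin] with ε h1 h2 hε
    have hI := integral_deficit (Q := Q) hρ ha ε (c - C * ε ^ 4)
    have hmono : ∫ x, (1 - 2 * sliceMass ε (c - C * ε ^ 4) (ρ x) (a x)) ∂Q ≤
        ∫ x, (ε * ρ x - {x | ρ x = 0}.indicator 1 x) ∂Q := by
      refine integral_mono (integrable_deficit hρ ha _ _)
        ((hρi.const_mul ε).sub hSi) fun x => ?_
      by_cases hx : ρ x = 0
      · have : x ∈ {x | ρ x = 0} := hx
        simp only [indicator_of_mem this, hx, sliceMass_zero hε h2.le, Pi.one_apply]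
        norm_num
      · have : x ∉ {x | ρ x = 0} := hx
        simp only [indicator_of_notMem this, sub_zero]
        exact one_sub_two_mul_sliceMass_le hε h2.le (hρ0 x) (ha1 x)
    rw [integral_sub (hρi.const_mul ε) hSi,
      integral_const_mul, integral_indicator_one hS] at hmono
    linarith
  have hlim : Tendsto (fun ε : ℝ => ε * ∫ x, ρ x ∂Q) (𝓝[>] 0) (𝓝 0) := by
    have : ContinuousAt (fun ε : ℝ => ε * ∫ x, ρ x ∂Q) 0 := by fun_prop
    simpa using this.tendsto.mono_left nhdsWithin_le_nhds
  have h0 : Q.real {x | ρ x = 0} = 0 := le_antisymm (ge_of_tendsto hlim hle) measureReal_nonneg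
  rw [measureReal_eq_zero_iff] at h0
  filter_upwards [measure_eq_zero_iff_ae_notMem.1 h0] with x hx
  exact (hρ0 x).lt_of_ne' hx

/-- The first order condition: the average of `1 / ρ` is finite and the average of
`ρ a - c / ρ` is nonnegative. -/
theorem first_order_condition (hρ : Measurable ρ) (ha : Measurable a)
    (ha0 : ∀ x, 0 ≤ a x) (ha1 : ∀ x, a x ≤ 1) (hρi : Integrable ρ Q) {c C : ℝ} (hc : 0 < c)
    (hpos : ∀ᵐ x ∂Q, 0 < ρ x)
    (hlow : ∀ᶠ ε in 𝓝[>] (0 : ℝ), ∫ x, sliceMass ε (c - C * ε ^ 4) (ρ x) (a x) ∂Q ≤ 1 / 2) :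
    Integrable (fun x => (ρ x)⁻¹) Q ∧ Integrable (fun x => ρ x * a x - c / ρ x) Q ∧
      0 ≤ ∫ x, (ρ x * a x - c / ρ x) ∂Q := by
  obtain ⟨e, he⟩ := exists_seq_tendsto (𝓝[>] (0 : ℝ))
  have he0 : Tendsto e atTop (𝓝 0) := he.mono_right nhdsWithin_le_nhds
  have e1 : ∀ᶠ ε in 𝓝 (0 : ℝ), 0 < c - C * ε ^ 4 := by
    have : ContinuousAt (fun ε : ℝ => c - C * ε ^ 4) 0 := by fun_prop
    exact this.eventually_const_lt (by simpa)
  -- These functions are nonnegative by `one_sub_two_mul_sliceMass_le`, so Fatou's lemma applies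
  -- although the limit `ρ - (ρ a - c / ρ)` is not known to be integrable beforehand.
  set f : ℕ → Ω → ℝ := fun n x =>
    ρ x - (1 - 2 * sliceMass (e n) (c - C * e n ^ 4) (ρ x) (a x)) / e n with hf
  have hfm : ∀ n, Measurable (f n) := fun n =>
    hρ.sub ((measurable_deficit hρ ha _ _).div_const _)
  have hfi : ∀ n, Integrable (f n) Q := fun n =>
    hρi.sub ((integrable_deficit hρ ha _ _).div_const _)
  have hfatou := lintegral_liminf_le (μ := Q) (u := atTop)
    (fun n => (hfm n).ennreal_ofReal)
  have hright : liminf (fun n => ∫⁻ x, ENNReal.ofReal (f n x) ∂Q) atTop ≤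
      ENNReal.ofReal (∫ x, ρ x ∂Q) := by
    refine (liminf_le_liminf (v := fun _ => ENNReal.ofReal (∫ x, ρ x ∂Q)) ?_).trans
      (liminf_const _).le
    filter_upwards [he.eventually hlow, he.eventually self_mem_nhdsWithin,
      he0.eventually e1] with n h1 h2 h3
    have h2 : 0 < e n := h2
    rw [← ofReal_integral_eq_lintegral_ofReal (hfi n)]
    · refine ENNReal.ofReal_le_ofReal ?_
      simp only [hf]
      rw [integral_sub hρi ((integrable_deficit hρ ha _ _).div_const _), integral_div,
        integral_deficit hρ ha]
      have : 0 ≤ (1 - 2 * ∫ x, sliceMass (e n) (c - C * e n ^ 4) (ρ x) (a x) ∂Q) / e n :=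
        div_nonneg (by linarith) h2.le
      linarith
    · filter_upwards [hpos] with x hx
      simp only [Pi.zero_apply, hf, sub_nonneg]
      rw [div_le_iff₀ h2, mul_comm (ρ x)]
      exact one_sub_two_mul_sliceMass_le h2 h3.le hx.le (ha1 x)
  have hleft : ∫⁻ x, ENNReal.ofReal (ρ x - (ρ x * a x - c / ρ x)) ∂Q ≤
      ∫⁻ x, liminf (fun n => ENNReal.ofReal (f n x)) atTop ∂Q := by
    refine lintegral_mono_ae ?_
    filter_upwards [hpos] with x hx
    have hlim : Tendsto (fun n => ENNReal.ofReal (ρ x - (ρ x * a x - c / ρ x + e n))) atTop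
        (𝓝 (ENNReal.ofReal (ρ x - (ρ x * a x - c / ρ x)))) := by
      refine ENNReal.tendsto_ofReal ?_
      have : Tendsto (fun n => ρ x - (ρ x * a x - c / ρ x + e n)) atTop
          (𝓝 (ρ x - (ρ x * a x - c / ρ x + 0))) := (he0.const_add _).const_sub _
      simpa using this
    rw [← hlim.liminf_eq]
    refine liminf_le_liminf ?_
    filter_upwards [he.eventually self_mem_nhdsWithin, he.eventually
      (eventually_one_sub_two_mul_sliceMass_le (C := C) hc hx (ha1 x) (ha0 x))] with n h2 h3
    refine ENNReal.ofReal_le_ofReal (sub_le_sub_left ?_ _)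
    rw [div_le_iff₀ h2]
    exact h3.trans_eq (mul_comm _ _)
  have hmain := hleft.trans (hfatou.trans hright)
  have hg0 : 0 ≤ᵐ[Q] fun x => ρ x - (ρ x * a x - c / ρ x) := by
    filter_upwards [hpos] with x hx
    have : 0 < c / ρ x := div_pos hc hx
    simp only [Pi.zero_apply]
    nlinarith [ha1 x]
  have hgm : Measurable fun x => ρ x - (ρ x * a x - c / ρ x) := by fun_prop
  have hgi : Integrable (fun x => ρ x - (ρ x * a x - c / ρ x)) Q := by
    refine ⟨hgm.aestronglyMeasurable, ?_⟩
    rw [hasFiniteIntegral_iff_ofReal hg0]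
    exact hmain.trans_lt ENNReal.ofReal_lt_top
  have hDi : Integrable (fun x => ρ x * a x - c / ρ x) Q := by
    refine (hρi.sub hgi).congr (Eventually.of_forall fun x => ?_)
    simp
  have hai : Integrable (fun x => ρ x * a x) Q := by
    refine hρi.mul_bdd (c := 1) ha.aestronglyMeasurable (Eventually.of_forall fun x => ?_)
    rw [Real.norm_of_nonneg (ha0 x)]
    exact ha1 x
  refine ⟨?_, hDi, ?_⟩
  · refine ((hai.sub hDi).const_mul c⁻¹).congr (Eventually.of_forall fun x => ?_)
    simp only [Pi.sub_apply, sub_sub_cancel]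
    rw [div_eq_mul_inv, inv_mul_cancel_left₀ hc.ne']
  · rw [← ofReal_integral_eq_lintegral_ofReal hgi hg0, ENNReal.ofReal_le_ofReal_iff
      (integral_nonneg_of_ae (hpos.mono fun x hx => hx.le)), integral_sub hρi hDi] at hmain
    linarith

/-- The second order obstruction: the third order term of the expansion is an average of squares,
hence all of them vanish. -/
theorem second_order_condition (hρ : Measurable ρ) (ha : Measurable a)
    (ha0 : ∀ x, 0 ≤ a x) (ha1 : ∀ x, a x ≤ 1) (hρi : Integrable ρ Q)
    (hρ3 : Integrable (fun x => ρ x ^ 3) Q) {c C : ℝ} (hc : 0 < c) (hC : 0 ≤ C)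
    (hpos : ∀ᵐ x ∂Q, 0 < ρ x)
    (hup : ∀ᶠ ε in 𝓝[>] (0 : ℝ), 1 / 2 ≤ ∫ x, sliceMass ε (c + C * ε ^ 4) (ρ x) (a x) ∂Q)
    (hlow : ∀ᶠ ε in 𝓝[>] (0 : ℝ), ∫ x, sliceMass ε (c - C * ε ^ 4) (ρ x) (a x) ∂Q ≤ 1 / 2) :
    ∀ᵐ x ∂Q, ρ x * (1 - a x) * (ρ x * a x - c / ρ x) ^ 2 / 2 = 0 := by
  obtain ⟨hinv, hDi, hD0⟩ := first_order_condition hρ ha ha0 ha1 hρi hc hpos hlow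
  obtain ⟨e, he⟩ := exists_seq_tendsto (𝓝[>] (0 : ℝ))
  have he0 : Tendsto e atTop (𝓝 0) := he.mono_right nhdsWithin_le_nhds
  set D : ℝ → Ω → ℝ := fun ε x => ρ x * a x - (c + C * ε ^ 4) / ρ x with hD
  have hDm : ∀ ε, Measurable (D ε) := fun ε => by fun_prop
  have hDeq : ∀ ε x, D ε x = (ρ x * a x - c / ρ x) - C * ε ^ 4 * (ρ x)⁻¹ := fun ε x => by
    simp only [hD]
    ring
  have hDεi : ∀ ε, Integrable (D ε) Q := fun ε => by
    refine (hDi.sub (hinv.const_mul (C * ε ^ 4))).congr (Eventually.of_forall fun x => ?_)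
    simp [hDeq]
  have hDint : ∀ ε, -(C * ε ^ 4 * ∫ x, (ρ x)⁻¹ ∂Q) ≤ ∫ x, D ε x ∂Q := fun ε => by
    simp only [hDeq]
    rw [integral_sub hDi (hinv.const_mul _), integral_const_mul]
    linarith
  set H : ℝ → Ω → ℝ := fun ε x => 1 - 2 * sliceMass ε (c + C * ε ^ 4) (ρ x) (a x) with hH
  have hHi : ∀ ε, Integrable (H ε) Q := fun ε => integrable_deficit hρ ha _ _
  -- Adding `ρ ^ 3` makes the rescaled remainder nonnegative, by `le_one_sub_two_mul_sliceMass`.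
  set f : ℕ → Ω → ℝ := fun n x => (H (e n) x - e n * D (e n) x) / e n ^ 3 + ρ x ^ 3 with hf
  have hfm : ∀ n, Measurable (f n) := fun n =>
    (((measurable_deficit hρ ha _ _).sub ((hDm _).const_mul _)).div_const _).add (hρ.pow_const 3)
  have hfi : ∀ n, Integrable (f n) Q := fun n =>
    (((hHi _).sub ((hDεi _).const_mul _)).div_const _).add hρ3
  have hdiff : ∀ ε, Integrable (fun x => H ε x - ε * D ε x) Q := fun ε =>
    (hHi ε).sub ((hDεi ε).const_mul ε)
  have hfatou := lintegral_liminf_le (μ := Q) (u := atTop)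
    (fun n => (hfm n).ennreal_ofReal)
  have hright : liminf (fun n => ∫⁻ x, ENNReal.ofReal (f n x) ∂Q) atTop ≤
      ENNReal.ofReal (∫ x, ρ x ^ 3 ∂Q) := by
    have hlim : Tendsto (fun n => ENNReal.ofReal
        (C * e n ^ 2 * (∫ x, (ρ x)⁻¹ ∂Q) + ∫ x, ρ x ^ 3 ∂Q)) atTop
        (𝓝 (ENNReal.ofReal (∫ x, ρ x ^ 3 ∂Q))) := by
      refine ENNReal.tendsto_ofReal ?_
      simpa using (((he0.pow 2).const_mul C).mul_const (∫ x, (ρ x)⁻¹ ∂Q)).add_const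
        (∫ x, ρ x ^ 3 ∂Q)
    rw [← hlim.liminf_eq]
    refine liminf_le_liminf ?_
    filter_upwards [he.eventually hup, he.eventually self_mem_nhdsWithin] with n h1 h2
    have h2 : 0 < e n := h2
    rw [← ofReal_integral_eq_lintegral_ofReal (hfi n)]
    · refine ENNReal.ofReal_le_ofReal ?_
      simp only [hf]
      rw [integral_add ((hdiff _).div_const _) hρ3, integral_div,
        integral_sub (hHi _) ((hDεi _).const_mul _), integral_const_mul]
      refine add_le_add_left ?_ _
      have hH0 : ∫ x, H (e n) x ∂Q ≤ 0 := by
        simp only [hH]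
        rw [integral_deficit hρ ha]
        linarith
      rw [div_le_iff₀ (by positivity)]
      have := mul_le_mul_of_nonneg_left (hDint (e n)) h2.le
      calc _ ≤ 0 - e n * -(C * e n ^ 4 * ∫ x, (ρ x)⁻¹ ∂Q) := by linarith
        _ = _ := by ring
    · filter_upwards [hpos] with x hx
      have hle := le_one_sub_two_mul_sliceMass (c := c + C * e n ^ 4) h2 (by positivity) hx (ha1 x)
      simp only [Pi.zero_apply, hf]
      rw [← neg_le_iff_add_nonneg, le_div_iff₀ (by positivity)]
      simp only [hH, hD]
      linarith
  set W : Ω → ℝ := fun x => ρ x * (1 - a x) * (ρ x * a x - c / ρ x) ^ 2 / 2 with hW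
  have hWm : Measurable W := by fun_prop
  have hleft : ∫⁻ x, ENNReal.ofReal (ρ x ^ 3 + W x) ∂Q ≤
      ∫⁻ x, liminf (fun n => ENNReal.ofReal (f n x)) atTop ∂Q := by
    refine lintegral_mono_ae ?_
    filter_upwards [hpos] with x hx
    have hlim : Tendsto (fun n => ENNReal.ofReal
        (ρ x ^ 3 + ρ x * (1 - a x) * D (e n) x ^ 2 / 2)) atTop
        (𝓝 (ENNReal.ofReal (ρ x ^ 3 + W x))) := by
      refine ENNReal.tendsto_ofReal ?_
      have hc : ContinuousAt (fun ε : ℝ => ρ x ^ 3 + ρ x * (1 - a x) * D ε x ^ 2 / 2) 0 := by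
        simp only [hD]
        fun_prop
      have := hc.tendsto.comp he0
      simpa [hD, hW, Function.comp_def] using this
    rw [← hlim.liminf_eq]
    refine liminf_le_liminf ?_
    filter_upwards [he.eventually self_mem_nhdsWithin, he.eventually
      (eventually_le_one_sub_two_mul_sliceMass (c := c) (C := C) hx (ha1 x))] with n h2 h3
    have h2 : 0 < e n := h2
    refine ENNReal.ofReal_le_ofReal ?_
    simp only [hf]
    rw [add_comm]
    refine add_le_add_left ?_ _
    rw [le_div_iff₀ (by positivity)]
    simp only [hH, hD]
    linarith
  have hmain := hleft.trans (hfatou.trans hright)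
  have hW0 : ∀ᵐ x ∂Q, 0 ≤ W x := by
    filter_upwards [hpos] with x hx
    have : 0 ≤ 1 - a x := sub_nonneg.2 (ha1 x)
    simp only [hW]
    positivity
  have hsplit : ∫⁻ x, ENNReal.ofReal (ρ x ^ 3 + W x) ∂Q =
      ENNReal.ofReal (∫ x, ρ x ^ 3 ∂Q) + ∫⁻ x, ENNReal.ofReal (W x) ∂Q := by
    rw [ofReal_integral_eq_lintegral_ofReal hρ3
      (hpos.mono fun x hx => by simp only [Pi.zero_apply]; positivity),
      ← lintegral_add_right _ hWm.ennreal_ofReal]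
    refine lintegral_congr_ae ?_
    filter_upwards [hpos, hW0] with x hx hx'
    exact ENNReal.ofReal_add (by positivity) hx'
  rw [hsplit] at hmain
  have hzero : ∫⁻ x, ENNReal.ofReal (W x) ∂Q = 0 := by
    by_contra hne
    exact absurd hmain (not_le.2 (ENNReal.lt_add_right ENNReal.ofReal_ne_top hne))
  rw [lintegral_eq_zero_iff hWm.ennreal_ofReal] at hzero
  filter_upwards [hzero, hW0] with x hx hx'
  exact le_antisymm (ENNReal.ofReal_eq_zero.1 hx) hx'

end Average

/-! ### The obstruction for a radial kernel -/

theorem smul_sphericalPoint_mem_iff {t : ℝ} (ht : t ∈ Ioo (-1 : ℝ) 1) (ε c ρ α : ℝ) :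
    ρ • sphericalPoint (t, α) ∈ {z : Space 3 | ε * (z 0 ^ 2 + z 1 ^ 2) - z 0 ≤ c * ε} ↔
      ε * (ρ ^ 2 * (t ^ 2 + (1 - t ^ 2) * cos α ^ 2)) - ρ * t ≤ c * ε := by
  have h0 : 0 ≤ 1 - t ^ 2 := by nlinarith [ht.1, ht.2]
  simp only [sphericalPoint, mem_ofPred_eq, PiLp.smul_apply, smul_eq_mul,
    Matrix.cons_val_zero, Matrix.cons_val_one]
  rw [mul_pow, mul_pow, mul_pow, Real.sq_sqrt h0, ← mul_add]

theorem integral_sliceMass_eq_lintegral (μ : Measure (Space 3)) (ε c : ℝ) :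
    ∫ p, sliceMass ε c ‖p.1‖ (cos p.2 ^ 2) ∂(μ.prod angleMeasure) =
      (∫⁻ z, ∫⁻ α, ENNReal.ofReal (sliceMass ε c ‖z‖ (cos α ^ 2)) ∂angleMeasure ∂μ).toReal := by
  have hm : Measurable fun p : Space 3 × ℝ => sliceMass ε c ‖p.1‖ (cos p.2 ^ 2) :=
    measurable_sliceMass_comp (by fun_prop) (by fun_prop) ε c
  have h0 : 0 ≤ᵐ[μ.prod angleMeasure] fun p => sliceMass ε c ‖p.1‖ (cos p.2 ^ 2) :=
    Eventually.of_forall fun p => sliceMass_nonneg _ _ _ _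
  rw [integral_eq_lintegral_of_nonneg_ae h0 hm.aestronglyMeasurable,
    lintegral_prod _ hm.ennreal_ofReal.aemeasurable]

/-- The mass of the sublevel set is the average of its relative length over radii and longitudes. -/
theorem real_sublevel_eq_integral_sliceMass {μ : Measure (Space 3)} [IsProbabilityMeasure μ]
    (hμ : ∀ ξ ξ' : Space 3, ‖ξ‖ = ‖ξ'‖ → charFun μ ξ = charFun μ ξ') (ε c : ℝ) :
    μ.real {z | ε * (z 0 ^ 2 + z 1 ^ 2) - z 0 ≤ c * ε} =
      ∫ p, sliceMass ε c ‖p.1‖ (cos p.2 ^ 2) ∂(μ.prod angleMeasure) := by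
  set B : Set (Space 3) := {z | ε * (z 0 ^ 2 + z 1 ^ 2) - z 0 ≤ c * ε} with hB
  have hBm : MeasurableSet B := measurableSet_le (by fun_prop) (by fun_prop)
  set T : Space 3 × ℝ × ℝ → Space 3 := fun p => ‖p.1‖ • sphericalPoint p.2 with hT
  have hTm : Measurable T :=
    measurable_fst.norm.smul (measurable_sphericalPoint.comp measurable_snd)
  have hslice : ∀ z : Space 3, ∀ α : ℝ, heightMeasure {t | T (z, t, α) ∈ B} =
      ENNReal.ofReal (sliceMass ε c ‖z‖ (cos α ^ 2)) := by
    intro z α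
    rw [sliceMass, ofReal_measureReal]
    refine measure_congr (eventuallyEq_set.2 ?_)
    filter_upwards [ae_heightMeasure] with t ht
    exact smul_sphericalPoint_mem_iff ht ε c ‖z‖ α
  rw [integral_sliceMass_eq_lintegral, measureReal_def]
  have key : μ B = ∫⁻ z, ∫⁻ α, heightMeasure {t | T (z, t, α) ∈ B} ∂angleMeasure ∂μ := by
    have hmap : μ B = (μ.prod (heightMeasure.prod angleMeasure)).map T B :=
      congrArg (fun ν : Measure (Space 3) => ν B) (eq_map_norm_smul_sphericalPoint hμ)
    rw [hmap, Measure.map_apply hTm hBm, Measure.prod_apply (hTm hBm)]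
    refine lintegral_congr fun z => ?_
    rw [Measure.prod_apply_symm (measurable_prodMk_left (hTm hBm))]
    rfl
  rw [key]
  simp only [hslice]

theorem speed_eq_zero_of_radial {μ : Measure (Space 3)} [IsProbabilityMeasure μ]
    (hμ : ∀ ξ ξ' : Space 3, ‖ξ‖ = ‖ξ'‖ → charFun μ ξ = charFun μ ξ')
    (h1 : Integrable (fun z => ‖z‖) μ) (h3 : Integrable (fun z => ‖z‖ ^ 3) μ) {c C : ℝ}
    (hC : 0 ≤ C)
    (hup : ∀ᶠ ε in 𝓝[>] (0 : ℝ),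
      1 / 2 ≤ μ.real {z | ε * (z 0 ^ 2 + z 1 ^ 2) - z 0 ≤ (c + C * ε ^ 4) * ε})
    (hlow : ∀ᶠ ε in 𝓝[>] (0 : ℝ),
      μ.real {z | ε * (z 0 ^ 2 + z 1 ^ 2) - z 0 ≤ (c - C * ε ^ 4) * ε} ≤ 1 / 2) :
    c = 0 := by
  simp only [real_sublevel_eq_integral_sliceMass hμ] at hup hlow
  have hρ : Measurable fun p : Space 3 × ℝ => ‖p.1‖ := by fun_prop
  have ha : Measurable fun p : Space 3 × ℝ => cos p.2 ^ 2 := by fun_prop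
  have hρ0 : ∀ p : Space 3 × ℝ, 0 ≤ ‖p.1‖ := fun p => norm_nonneg _
  have ha0 : ∀ p : Space 3 × ℝ, 0 ≤ cos p.2 ^ 2 := fun p => sq_nonneg _
  have ha1 : ∀ p : Space 3 × ℝ, cos p.2 ^ 2 ≤ 1 := fun p => Real.cos_sq_le_one _
  rcases (nonneg_of_half_le_integral_sliceMass hρ ha hρ0 ha0 ha1 hup).eq_or_lt with hc | hc
  · exact hc.symm
  have hρi : Integrable (fun p : Space 3 × ℝ => ‖p.1‖) (μ.prod angleMeasure) :=
    h1.comp_fst angleMeasure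
  have hpos := ae_pos_of_integral_sliceMass_le hρ ha hρ0 ha1 hρi hc hlow
  have hW := second_order_condition hρ ha ha0 ha1 hρi (h3.comp_fst angleMeasure) hc hC hpos hup hlow
  obtain ⟨z, hz⟩ := (Measure.ae_ae_of_ae_prod (hpos.and hW)).exists
  have hz0 : 0 < ‖z‖ := (hz.exists).choose_spec.1
  -- the average over longitudes forces the continuous integrand to vanish at every longitude
  have hvol : ∀ᵐ α ∂(volume.restrict (Ioo (-Real.pi) Real.pi)),
      ‖z‖ * (1 - cos α ^ 2) * (‖z‖ * cos α ^ 2 - c / ‖z‖) ^ 2 / 2 = 0 := by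
    refine (Measure.ae_ennreal_smul_measure_iff (c := (volume (Ioo (-Real.pi) Real.pi))⁻¹) ?_).1
      (hz.mono fun α h => h.2)
    simp
  have hall := Measure.eqOn_open_of_ae_eq (g := fun _ => (0 : ℝ)) hvol isOpen_Ioo
    (by fun_prop) (by fun_prop)
  -- at longitude `π / 2` the vanishing quantity is `c ^ 2 / (2 ‖z‖)`
  have hhalf := hall (show Real.pi / 2 ∈ Ioo (-Real.pi) Real.pi from
    ⟨by linarith [Real.pi_pos], by linarith [Real.pi_pos]⟩)
  simpa [hz0.ne'] using hhalf

theorem charFun_map_castAdd_eq {m : ℕ} {K : Measure (Space (3 + m))}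
    (hK : ∀ A : Space (3 + m) ≃ₗᵢ[ℝ] Space (3 + m), K.map A = K) {ξ ξ' : Space 3}
    (hξ : ‖ξ‖ = ‖ξ'‖) :
    charFun (K.map fun z => (WithLp.toLp 2 fun j => z (Fin.castAdd m j) : Space 3)) ξ =
      charFun (K.map fun z => (WithLp.toLp 2 fun j => z (Fin.castAdd m j) : Space 3)) ξ' := by
  -- `ι` is the adjoint of the coordinate projection, an isometric embedding.
  set ι : Space 3 → Space (3 + m) := fun ξ => WithLp.toLp 2 (Fin.append ξ.ofLp 0) with hι
  have hnorm : ∀ ξ, ‖ι ξ‖ = ‖ξ‖ := fun ξ => by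
    simp [EuclideanSpace.norm_eq, hι, Fin.sum_univ_add]
  have hchar : ∀ ξ, charFun (K.map fun z =>
      (WithLp.toLp 2 fun j => z (Fin.castAdd m j) : Space 3)) ξ = charFun K (ι ξ) := fun ξ => by
    rw [charFun_apply, charFun_apply, integral_map (by fun_prop) (by fun_prop)]
    congr 1
    funext z
    simp [PiLp.inner_apply, hι, Fin.sum_univ_add]
  rw [hchar, hchar]
  exact charFun_eq_of_norm_eq hK (by rw [hnorm, hnorm, hξ])

/-- The sublevel sets only see the first two coordinates, so the kernel may be replaced by its
marginal on the first three, which is again radial. -/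
theorem speed_eq_zero_of_isRadialKernel {m : ℕ} {K : Measure (Space (3 + m))}
    (hK : IsRadialKernel K) {c C : ℝ} (hC : 0 ≤ C)
    (hup : ∀ᶠ ε in 𝓝[>] (0 : ℝ), 1 / 2 ≤ K.real {z | ε * (z (Fin.castAdd m 0) ^ 2 +
      z (Fin.castAdd m 1) ^ 2) - z (Fin.castAdd m 0) ≤ (c + C * ε ^ 4) * ε})
    (hlow : ∀ᶠ ε in 𝓝[>] (0 : ℝ), K.real {z | ε * (z (Fin.castAdd m 0) ^ 2 +
      z (Fin.castAdd m 1) ^ 2) - z (Fin.castAdd m 0) ≤ (c - C * ε ^ 4) * ε} ≤ 1 / 2) :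
    c = 0 := by
  have : IsProbabilityMeasure K := ⟨hK.unit_mass⟩
  set π : Space (3 + m) → Space 3 := fun z => WithLp.toLp 2 fun j => z (Fin.castAdd m j) with hπ
  have hπm : Measurable π := by fun_prop
  have hπn : ∀ z, ‖π z‖ ≤ ‖z‖ := fun z => by
    rw [EuclideanSpace.norm_eq, EuclideanSpace.norm_eq, Fin.sum_univ_add]
    refine Real.sqrt_le_sqrt ?_
    simp only [hπ]
    exact le_add_of_nonneg_right (Finset.sum_nonneg fun i _ => sq_nonneg _)
  have : IsProbabilityMeasure (K.map π) := Measure.isProbabilityMeasure_map hπm.aemeasurable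
  have hint : ∀ n, Integrable (fun z => ‖z‖ ^ n) (K.map π) := fun n => by
    rw [integrable_map_measure (by fun_prop) hπm.aemeasurable]
    refine (hK.rapid_decay n).mono (by fun_prop) (Eventually.of_forall fun z => ?_)
    simp only [Function.comp_apply, norm_pow, norm_norm]
    exact pow_le_pow_left₀ (norm_nonneg _) (hπn z) n
  have hmass : ∀ ε s : ℝ, (K.map π).real {z | ε * (z 0 ^ 2 + z 1 ^ 2) - z 0 ≤ s} =
      K.real {z | ε * (z (Fin.castAdd m 0) ^ 2 + z (Fin.castAdd m 1) ^ 2) -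
        z (Fin.castAdd m 0) ≤ s} := fun ε s => by
    rw [map_measureReal_apply hπm (measurableSet_le (by fun_prop) (by fun_prop))]
    rfl
  refine speed_eq_zero_of_radial (μ := K.map π) (fun ξ ξ' h => charFun_map_castAdd_eq hK.radial h)
    (by simpa using hint 1) (hint 3) hC ?_ ?_
  · simpa only [hmass] using hup
  · simpa only [hmass] using hlow

/-! ### Shrinking cylinders -/

section Cylinder

variable {d : ℕ} {i j : Fin d}

/-- A bounded level set function of the cylinders `y i ^ 2 + y j ^ 2 = const` moving by mean
curvature at speed `c`. -/
noncomputable def cylinderFlow (i j : Fin d) (c t : ℝ) (y : Space d) : ℝ :=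
  Real.exp (-(y i ^ 2 + y j ^ 2) - 2 * c * t)

/-- The orthogonal projection onto the plane of the coordinates `i` and `j`. -/
noncomputable def planeProj (i j : Fin d) : Space d →L[ℝ] Space d :=
  (EuclideanSpace.proj i : Space d →L[ℝ] ℝ).smulRight (EuclideanSpace.single i 1) +
    (EuclideanSpace.proj j : Space d →L[ℝ] ℝ).smulRight (EuclideanSpace.single j 1)

theorem inner_planeProj (y v : Space d) :
    inner ℝ (planeProj i j y) v = y i * v i + y j * v j := by
  simp [planeProj, inner_add_left, inner_smul_left, EuclideanSpace.inner_single_left]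

theorem hasFDerivAt_coord (i : Fin d) (y : Space d) :
    HasFDerivAt (fun y : Space d => y i) (EuclideanSpace.proj i : Space d →L[ℝ] ℝ) y :=
  (EuclideanSpace.proj i : Space d →L[ℝ] ℝ).hasFDerivAt

theorem hasFDerivAt_sq_add_sq (y : Space d) :
    HasFDerivAt (fun y : Space d => y i ^ 2 + y j ^ 2)
      ((2 : ℝ) • innerSL ℝ (planeProj i j y)) y := by
  refine (((hasFDerivAt_coord i y).pow 2).add ((hasFDerivAt_coord j y).pow 2)).congr_fderiv ?_
  ext v
  simp [inner_planeProj]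
  ring

theorem gradient_cylinderFlow (c t : ℝ) (y : Space d) :
    ∇ (cylinderFlow i j c t) y = (-2 * cylinderFlow i j c t y) • planeProj i j y := by
  refine HasGradientAt.gradient ?_
  rw [hasGradientAt_iff_hasFDerivAt]
  refine (((hasFDerivAt_sq_add_sq (i := i) (j := j) y).neg.sub_const (2 * c * t)).exp).congr_fderiv ?_
  ext v
  simp [inner_planeProj, cylinderFlow]
  ring

theorem norm_planeProj (hij : i ≠ j) (y : Space d) :
    ‖planeProj i j y‖ = √(y i ^ 2 + y j ^ 2) := by
  rw [norm_eq_sqrt_real_inner, inner_planeProj]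
  simp [planeProj, hij, hij.symm]
  ring_nf

/-- The mean curvature of a cylinder of radius `s` is `1 / s`. -/
theorem divergence_normal (hij : i ≠ j) {y : Space d} (hy : 0 < y i ^ 2 + y j ^ 2) :
    divergence (fun y => -((√(y i ^ 2 + y j ^ 2))⁻¹ • planeProj i j y)) y =
      -(√(y i ^ 2 + y j ^ 2))⁻¹ := by
  have hs : 0 < √(y i ^ 2 + y j ^ 2) := Real.sqrt_pos.2 hy
  have hs2 : √(y i ^ 2 + y j ^ 2) ^ 2 = y i ^ 2 + y j ^ 2 := Real.sq_sqrt hy.le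
  have h1 := (hasDerivAt_inv hs.ne').comp_hasFDerivAt y
    ((hasFDerivAt_sq_add_sq (i := i) (j := j) y).sqrt hy.ne')
  have h2 : HasFDerivAt (fun y => -((√(y i ^ 2 + y j ^ 2))⁻¹ • planeProj i j y)) _ y :=
    (h1.smul (planeProj i j).hasFDerivAt).neg
  rw [divergence, h2.fderiv]
  set s := √(y i ^ 2 + y j ^ 2) with hsdef
  have hcoord : ∀ (y : Space d) (k : Fin d), planeProj i j y k =
      (if k = i then y i else 0) + (if k = j then y j else 0) := fun y k => by
    simp [planeProj]
  have hterm : ∀ k : Fin d, planeProj i j (EuclideanSpace.single k 1) k =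
      (if k = i then 1 else 0) + (if k = j then 1 else 0) := fun k => by
    rw [hcoord]
    by_cases hi : k = i <;> by_cases hj : k = j <;> simp [hi, hj, hij, hij.symm]
  have hsum : ∑ k : Fin d, (y i * (EuclideanSpace.single k (1 : ℝ) : Space d) i +
      y j * (EuclideanSpace.single k (1 : ℝ) : Space d) j) *
      ((if k = i then y i else 0) + (if k = j then y j else 0)) = s ^ 2 := by
    simp only [PiLp.single_apply, mul_add, add_mul, mul_one, mul_ite, ite_mul, zero_mul,
      Finset.sum_add_distrib, Finset.sum_ite_eq',
      Finset.mem_univ, if_true, hij, hij.symm, if_false, mul_zero, add_zero, zero_add]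
    rw [hs2]
    ring
  have hrank : ∑ k : Fin d, ((if k = i then 1 else 0) + (if k = j then (1 : ℝ) else 0)) = 2 := by
    simp [Finset.sum_add_distrib]
    norm_num
  simp only [Function.comp_apply, neg_apply, add_apply, smul_apply, PiLp.neg_apply,
    PiLp.add_apply, PiLp.smul_apply, ContinuousLinearMap.smulRight_apply, smul_eq_mul,
    innerSL_apply_apply, inner_planeProj, hterm, hcoord, ← hsdef]
  calc _ = -(s⁻¹ * ∑ k : Fin d, ((if k = i then 1 else 0) + (if k = j then (1 : ℝ) else 0))) +
        (s ^ 2)⁻¹ * s⁻¹ * ∑ k : Fin d, (y i * (EuclideanSpace.single k (1 : ℝ) : Space d) i +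
          y j * (EuclideanSpace.single k (1 : ℝ) : Space d) j) *
          ((if k = i then y i else 0) + (if k = j then y j else 0)) := by
        rw [Finset.mul_sum, Finset.mul_sum, ← Finset.sum_neg_distrib, ← Finset.sum_add_distrib]
        refine Finset.sum_congr rfl fun k _ => ?_
        field_simp
        ring
    _ = -s⁻¹ := by
        rw [hsum, hrank]
        field_simp
        norm_num

theorem levelSetOp_cylinderFlow (hij : i ≠ j) (c t : ℝ) {y : Space d}
    (hy : 0 < y i ^ 2 + y j ^ 2) :
    levelSetOp (cylinderFlow i j c t) y = -2 * cylinderFlow i j c t y := by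
  have hs : 0 < √(y i ^ 2 + y j ^ 2) := Real.sqrt_pos.2 hy
  have hexp : ∀ y, 0 < cylinderFlow i j c t y := fun y => Real.exp_pos _
  have hnorm : ∀ y, ‖∇ (cylinderFlow i j c t) y‖ =
      2 * cylinderFlow i j c t y * √(y i ^ 2 + y j ^ 2) := fun y => by
    rw [gradient_cylinderFlow, norm_smul, norm_planeProj hij, Real.norm_eq_abs, neg_mul, abs_neg,
      abs_of_pos (mul_pos two_pos (hexp y))]
  have hV : (fun y => ‖∇ (cylinderFlow i j c t) y‖⁻¹ • ∇ (cylinderFlow i j c t) y) =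
      fun y => -((√(y i ^ 2 + y j ^ 2))⁻¹ • planeProj i j y) := by
    funext y
    rw [hnorm, gradient_cylinderFlow, smul_smul, ← neg_smul]
    congr 1
    rw [mul_inv]
    have := (hexp y).ne'
    field_simp
  rw [levelSetOp, hV, hnorm, divergence_normal hij hy]
  field_simp

theorem isSmoothFlow_cylinderFlow (hij : i ≠ j) (c : ℝ) :
    IsSmoothFlow c (cylinderFlow i j c) 1 {y | 0 < y i} where
  smooth := by
    refine ContDiff.contDiffOn ?_
    unfold cylinderFlow
    fun_prop
  gradient_ne_zero := by
    intro t _ y hy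
    have hy : 0 < y i := hy
    rw [gradient_cylinderFlow]
    refine smul_ne_zero (mul_ne_zero (by norm_num) (Real.exp_pos _).ne') ?_
    rw [← norm_ne_zero_iff, norm_planeProj hij]
    positivity
  equation := by
    intro t _ y hy
    have hy : 0 < y i := hy
    rw [levelSetOp_cylinderFlow hij c t (by positivity)]
    have h : HasDerivAt (fun s => cylinderFlow i j c s y)
        (cylinderFlow i j c t y * (-(2 * c))) t := by
      refine HasDerivAt.exp ?_
      exact (((hasDerivAt_id t).const_mul (2 * c)).const_sub
        (-(y i ^ 2 + y j ^ 2))).congr_deriv (by simp)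
    rw [h.deriv]
    ring

/-- Consistency tested on the shrinking cylinder, at the point where it has radius one. -/
theorem IsConsistentOfOrder.cylinder {K : Measure (Space d)} {c : ℝ} {p : ℕ}
    (h : IsConsistentOfOrder K c p) (hij : i ≠ j) :
    (fun k : ℝ => medianStep K k (fun y => Real.exp (-(y i ^ 2 + y j ^ 2)))
      (EuclideanSpace.single i 1) - Real.exp (-1 - 2 * c * k)) =O[𝓝[>] 0]
      (fun k : ℝ => k ^ (p + 1)) := by
  have h0 : cylinderFlow i j c 0 = fun y => Real.exp (-(y i ^ 2 + y j ^ 2)) := by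
    funext y
    simp [cylinderFlow]
  have hk : ∀ k, cylinderFlow i j c k (EuclideanSpace.single i 1) = Real.exp (-1 - 2 * c * k) := by
    intro k
    simp [cylinderFlow, hij.symm]
  have := h (cylinderFlow i j c) 1 {y | 0 < y i} (EuclideanSpace.single i 1) one_pos
    (isOpen_lt (by fun_prop) (by fun_prop)) (by simp) (by rw [h0]; fun_prop)
    ⟨1, fun y => ?_⟩ (isSmoothFlow_cylinderFlow hij c)
  · simpa only [h0, hk] using this
  · rw [h0, abs_of_pos (Real.exp_pos _), Real.exp_le_one_iff]
    have : 0 ≤ y i ^ 2 + y j ^ 2 := by positivity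
    linarith

end Cylinder

/-! ### One step of the median filter on a cylinder -/

section Median

variable {d : ℕ} {i j : Fin d}

theorem superlevelMass_antitone (K : Measure (Space d)) [IsFiniteMeasure K] (φ : Space d → ℝ)
    (x : Space d) : Antitone (superlevelMass K φ x) := fun _ _ h =>
  measureReal_mono fun _ hz => h.trans hz

theorem half_le_superlevelMass_of_lt {K : Measure (Space d)} [IsProbabilityMeasure K]
    {φ : Space d → ℝ} (h0 : ∀ y, 0 ≤ φ y) {x : Space d} {l : ℝ} (hl : l < weightedMedian K φ x) :
    1 / 2 ≤ superlevelMass K φ x l := by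
  have hne : {l : ℝ | 1 / 2 ≤ superlevelMass K φ x l}.Nonempty := by
    refine ⟨0, ?_⟩
    have : {z | 0 ≤ φ (x - z)} = univ := eq_univ_of_forall fun z => h0 _
    rw [mem_ofPred_eq, superlevelMass, this]
    norm_num
  obtain ⟨l', hl', hll'⟩ := exists_lt_of_lt_csSup hne hl
  exact le_trans hl' (superlevelMass_antitone K φ x hll'.le)

theorem superlevelMass_lt_half_of_lt {K : Measure (Space d)} [IsProbabilityMeasure K]
    {φ : Space d → ℝ} {M : ℝ} (hM : ∀ y, φ y ≤ M) {x : Space d} {l : ℝ}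
    (hl : weightedMedian K φ x < l) : superlevelMass K φ x l < 1 / 2 := by
  by_contra! h
  refine hl.not_ge (le_csSup ⟨M, fun l' hl' => ?_⟩ h)
  by_contra! hlt
  have : {z | l' ≤ φ (x - z)} = ∅ := eq_empty_of_forall_notMem fun z hz =>
    (hlt.trans_le hz).not_ge (hM _)
  rw [mem_ofPred_eq, superlevelMass, this] at hl'
  norm_num at hl'

/-- The superlevel sets of the cylinder datum at a point of radius one, for the kernel scaled by
`2 ε = √(2 k)`, in the variable of the unscaled kernel. -/
theorem superlevelMass_cylinder (K : Measure (Space d)) (hij : i ≠ j) {ε : ℝ} (hε : 0 < ε)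
    (b : ℝ) :
    superlevelMass (scaledKernel K (√(2 * (2 * ε ^ 2))))
      (fun y => Real.exp (-(y i ^ 2 + y j ^ 2))) (EuclideanSpace.single i 1)
      (Real.exp (-1 - 4 * ε ^ 2 * b)) =
      K.real {z | ε * (z i ^ 2 + z j ^ 2) - z i ≤ b * ε} := by
  have hr : √(2 * (2 * ε ^ 2)) = 2 * ε := by
    rw [show 2 * (2 * ε ^ 2) = (2 * ε) ^ 2 by ring, Real.sqrt_sq (by positivity)]
  rw [superlevelMass, scaledKernel, hr, map_measureReal_apply (by fun_prop)
    (measurableSet_le measurable_const (by fun_prop))]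
  congr 1
  ext z
  simp only [mem_preimage, mem_ofPred_eq, Real.exp_le_exp, PiLp.sub_apply, PiLp.smul_apply,
    PiLp.single_apply, if_true, hij.symm, if_false, smul_eq_mul]
  have h4 : 0 < 4 * ε := by positivity
  rw [← mul_le_mul_iff_right₀ h4 (b := ε * (z i ^ 2 + z j ^ 2) - z i)]
  constructor <;> intro h <;> nlinarith

theorem exists_mass_bounds_of_isConsistentOfOrder_two {K : Measure (Space d)}
    [IsProbabilityMeasure K] {c : ℝ} (h : IsConsistentOfOrder K c 2) (hij : i ≠ j) :
    ∃ C : ℝ, 0 ≤ C ∧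
      (∀ᶠ ε in 𝓝[>] (0 : ℝ),
        1 / 2 ≤ K.real {z | ε * (z i ^ 2 + z j ^ 2) - z i ≤ (c + C * ε ^ 4) * ε}) ∧
      (∀ᶠ ε in 𝓝[>] (0 : ℝ),
        K.real {z | ε * (z i ^ 2 + z j ^ 2) - z i ≤ (c - C * ε ^ 4) * ε} ≤ 1 / 2) := by
  obtain ⟨C₀, hC₀, hbound⟩ := (h.cylinder hij).exists_pos
  have hlim : Tendsto (fun ε : ℝ => 2 * ε ^ 2) (𝓝[>] 0) (𝓝[>] 0) := by
    refine tendsto_nhdsWithin_iff.2 ⟨?_, ?_⟩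
    · have : ContinuousAt (fun ε : ℝ => 2 * ε ^ 2) 0 := by fun_prop
      simpa using this.tendsto.mono_left nhdsWithin_le_nhds
    · filter_upwards [self_mem_nhdsWithin] with ε hε
      have : 0 < ε := hε
      exact mem_Ioi.2 (by positivity)
  have hb := hlim.eventually hbound.bound
  -- Near the level `exp (-1 - 2 c k)`, which exceeds `exp (-2)` for small `k`, an error
  -- `C₀ k ^ 3 = 8 C₀ ε ^ 6` in the level is absorbed by a shift `4 C ε ^ 6` in the exponent.
  set C : ℝ := 4 * Real.exp 2 * (C₀ + 1) with hC
  have hCpos : 0 < C := by positivity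
  have e1 : ∀ᶠ ε in 𝓝 (0 : ℝ), 4 * ε ^ 2 * c < 1 := by
    have : ContinuousAt (fun ε : ℝ => 4 * ε ^ 2 * c) 0 := by fun_prop
    exact this.eventually_lt_const (by simp)
  have e2 : ∀ᶠ ε in 𝓝 (0 : ℝ), 4 * C * ε ^ 6 < 1 := by
    have : ContinuousAt (fun ε : ℝ => 4 * C * ε ^ 6) 0 := by fun_prop
    exact this.eventually_lt_const (by simp)
  have hr : ∀ ε : ℝ, IsProbabilityMeasure (scaledKernel K (√(2 * (2 * ε ^ 2)))) := fun ε =>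
    Measure.isProbabilityMeasure_map (by fun_prop)
  have hφ1 : ∀ y : Space d, Real.exp (-(y i ^ 2 + y j ^ 2)) ≤ 1 := fun y => by
    rw [Real.exp_le_one_iff, neg_nonpos]
    positivity
  have hmain : ∀ᶠ ε in 𝓝[>] (0 : ℝ), 0 < ε ∧
      Real.exp (-1 - 4 * ε ^ 2 * (c + C * ε ^ 4)) <
        medianStep K (2 * ε ^ 2) (fun y => Real.exp (-(y i ^ 2 + y j ^ 2)))
          (EuclideanSpace.single i 1) ∧
      medianStep K (2 * ε ^ 2) (fun y => Real.exp (-(y i ^ 2 + y j ^ 2)))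
          (EuclideanSpace.single i 1) < Real.exp (-1 - 4 * ε ^ 2 * (c - C * ε ^ 4)) := by
    filter_upwards [self_mem_nhdsWithin, hb, nhdsWithin_le_nhds e1, nhdsWithin_le_nhds e2]
      with ε hε h1 h2 h3
    have hε : 0 < ε := hε
    rw [Real.norm_eq_abs, Real.norm_of_nonneg (by positivity), abs_le] at h1
    set m := medianStep K (2 * ε ^ 2) (fun y => Real.exp (-(y i ^ 2 + y j ^ 2)))
      (EuclideanSpace.single i 1)
    have hexp : -1 - 2 * c * (2 * ε ^ 2) = -1 - 4 * ε ^ 2 * c := by ring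
    rw [hexp] at h1
    set v := Real.exp (-1 - 4 * ε ^ 2 * c) with hv
    set x := 4 * C * ε ^ 6 with hx
    have hx0 : 0 < x := by positivity
    have hvx : 8 * (C₀ + 1) * ε ^ 6 < v * x / 2 := by
      have hv2 : Real.exp (-2) < v := Real.exp_lt_exp.2 (by linarith)
      have : Real.exp (-2) * x / 2 = 8 * (C₀ + 1) * ε ^ 6 := by
        rw [hx, hC, Real.exp_neg]
        field_simp
        norm_num
      rw [← this]
      have := mul_lt_mul_of_pos_right hv2 hx0
      linarith
    have hε6 : 0 < ε ^ 6 := by positivity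
    have hv0 : 0 < v := Real.exp_pos _
    have hk : C₀ * (2 * ε ^ 2) ^ (2 + 1) = 8 * C₀ * ε ^ 6 := by ring
    rw [hk] at h1
    refine ⟨hε, ?_, ?_⟩
    · have h4 : Real.exp (-1 - 4 * ε ^ 2 * (c + C * ε ^ 4)) = v * Real.exp (-x) := by
        rw [hv, ← Real.exp_add]
        congr 1
        rw [hx]
        ring
      have h5 : Real.exp (-x) ≤ 1 - x / 2 := by
        rw [Real.exp_neg, inv_le_comm₀ (Real.exp_pos x) (by linarith)]
        refine le_trans ?_ (Real.add_one_le_exp x)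
        rw [inv_le_iff_one_le_mul₀ (by linarith)]
        nlinarith
      rw [h4]
      have := mul_le_mul_of_nonneg_left h5 hv0.le
      linarith
    · have h4 : Real.exp (-1 - 4 * ε ^ 2 * (c - C * ε ^ 4)) = v * Real.exp x := by
        rw [hv, ← Real.exp_add]
        congr 1
        rw [hx]
        ring
      rw [h4]
      have := mul_le_mul_of_nonneg_left (Real.add_one_le_exp x) hv0.le
      nlinarith
  refine ⟨C, hCpos.le, ?_, ?_⟩
  · filter_upwards [hmain] with ε ⟨hε, h1, _⟩
    rw [← superlevelMass_cylinder K hij hε]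
    have := hr ε
    exact half_le_superlevelMass_of_lt (fun y => (Real.exp_pos _).le) h1
  · filter_upwards [hmain] with ε ⟨hε, _, h2⟩
    rw [← superlevelMass_cylinder K hij hε]
    have := hr ε
    exact (superlevelMass_lt_half_of_lt hφ1 h2).le

/-! ### The speed of a consistent scheme -/

theorem IsConsistentOfOrder.mono {K : Measure (Space d)} {c : ℝ} {p q : ℕ} (hpq : p ≤ q)
    (h : IsConsistentOfOrder K c q) : IsConsistentOfOrder K c p := by
  intro u T U x hT hU hx hu hb hflow
  refine (h u T U x hT hU hx hu hb hflow).trans (IsBigO.of_bound 1 ?_)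
  have e1 : ∀ᶠ k in 𝓝 (0 : ℝ), k < 1 := eventually_lt_nhds one_pos
  filter_upwards [self_mem_nhdsWithin, nhdsWithin_le_nhds e1] with k hk h1
  have hk : 0 < k := hk
  rw [one_mul, norm_pow, norm_pow, Real.norm_of_nonneg hk.le]
  exact pow_le_pow_of_le_one hk.le h1.le (by omega)

theorem IsConsistentOfOrder.speed_unique {K : Measure (Space d)} {c c' : ℝ} (hij : i ≠ j)
    (h : IsConsistentOfOrder K c 1) (h' : IsConsistentOfOrder K c' 1) : c = c' := by
  set f : ℝ → ℝ := fun k => Real.exp (-1 - 2 * c * k) - Real.exp (-1 - 2 * c' * k) with hf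
  have hO : f =O[𝓝[>] 0] fun k : ℝ => k ^ (1 + 1) := by
    refine ((h'.cylinder hij).sub (h.cylinder hij)).congr_left fun k => ?_
    simp only [hf]
    ring
  have ho : f =o[𝓝[>] 0] fun k : ℝ => k := by
    refine hO.trans_isLittleO ?_
    simpa using ((isLittleO_pow_id (𝕜 := ℝ) (n := 2) one_lt_two).mono nhdsWithin_le_nhds)
  have hexp : ∀ a : ℝ, HasDerivAt (fun k : ℝ => Real.exp (-1 - 2 * a * k))
      (Real.exp (-1) * -(2 * a)) 0 := fun a => by
    have h := ((((hasDerivAt_id (0 : ℝ)).const_mul (2 * a)).const_sub (-1)).exp)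
    simpa using h
  have hd : HasDerivAt f (Real.exp (-1) * -(2 * c) - Real.exp (-1) * -(2 * c')) 0 :=
    (hexp c).sub (hexp c')
  have hsub : 𝓝[>] (0 : ℝ) ≤ 𝓝[≠] 0 := nhdsWithin_mono 0 fun k (hk : 0 < k) => hk.ne'
  have ht := (hasDerivAt_iff_tendsto_slope_zero.1 hd).mono_left hsub
  have hf0 : f 0 = 0 := by simp [hf]
  simp only [zero_add, hf0, sub_zero, smul_eq_mul] at ht
  have ht0 : Tendsto (fun k => k⁻¹ * f k) (𝓝[>] 0) (𝓝 0) := by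
    refine ho.tendsto_div_nhds_zero.congr fun k => ?_
    rw [div_eq_inv_mul]
  have hlim := tendsto_nhds_unique ht ht0
  have hpos := Real.exp_pos (-1)
  have : Real.exp (-1) * (c' - c) = 0 := by linarith
  rcases mul_eq_zero.1 this with h0 | h0
  · exact absurd h0 hpos.ne'
  · linarith

/-- In dimension at least three, a scheme that is consistent of order two does not move. -/
theorem IsConsistentOfOrder.speed_eq_zero (hd : 3 ≤ d) {K : Measure (Space d)}
    (hK : IsRadialKernel K) {c : ℝ} (h : IsConsistentOfOrder K c 2) : c = 0 := by
  obtain ⟨m, rfl⟩ := Nat.exists_eq_add_of_le hd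
  have : IsProbabilityMeasure K := ⟨hK.unit_mass⟩
  obtain ⟨C, hC, hup, hlow⟩ := exists_mass_bounds_of_isConsistentOfOrder_two
    (i := Fin.castAdd m 0) (j := Fin.castAdd m 1) h (by simp)
  exact speed_eq_zero_of_isRadialKernel hK hC hup hlow

end Median

/-! ### The matching conditions for the moments -/

theorem radialMoment_eq_zero_of_matching {κ : ℝ → ℝ} (h1 : radialMoment κ 1 ≠ 0)
    (hB01 : coeffB0 κ ^ 2 = 2 * coeffB1 κ) (hB13 : 6 * coeffB1 κ = coeffB3 κ) :
    radialMoment κ 5 = 0 ∧ coeffB0 κ = 0 := by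
  unfold coeffB0 coeffB1 at *
  unfold coeffB3 at hB13
  have h3 : radialMoment κ 3 ^ 2 / radialMoment κ 1 ^ 2 = 0 := by linarith
  have h3' : radialMoment κ 3 = 0 := by simpa [h1] using h3
  rw [h3'] at hB01 ⊢
  have h5 : radialMoment κ 5 / radialMoment κ 1 = 0 := by
    simp only [zero_div] at hB01
    linarith
  exact ⟨by simpa [h1] using h5, by simp⟩

end MedianFilter

theorem mainTheorem6 :
    (∀ (d : ℕ), 3 ≤ d → ∀ K : Measure (MedianFilter.Space d), MedianFilter.IsRadialKernel K →
      ¬ MedianFilter.IsConsistentOfOrder K 1 2 ∧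
      ∀ c : ℝ, MedianFilter.IsConsistentOfOrder K c 2 →
        c = 0 ∧ ∀ c' : ℝ, c' ≠ 0 → ¬ MedianFilter.IsConsistentOfOrder K c' 1) ∧
    (∀ κ : ℝ → ℝ,
      IntegrableOn (fun r : ℝ => r ^ 1 * κ r) (Ioi 0) →
      IntegrableOn (fun r : ℝ => r ^ 3 * κ r) (Ioi 0) →
      IntegrableOn (fun r : ℝ => r ^ 5 * κ r) (Ioi 0) →
      MedianFilter.radialMoment κ 1 ≠ 0 →
      MedianFilter.coeffB0 κ ^ 2 = 2 * MedianFilter.coeffB1 κ →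
      2 * MedianFilter.coeffB1 κ = -MedianFilter.coeffB2 κ →
      6 * MedianFilter.coeffB1 κ = MedianFilter.coeffB3 κ →
      MedianFilter.radialMoment κ 5 = 0 ∧ MedianFilter.coeffB0 κ = 0) := by
  refine ⟨fun d hd K hK => ⟨fun h => one_ne_zero (h.speed_eq_zero hd hK), fun c h => ?_⟩,
    fun κ _ _ _ h1 hB01 _ hB13 =>
      MedianFilter.radialMoment_eq_zero_of_matching h1 hB01 hB13⟩
  have hc := h.speed_eq_zero hd hK
  refine ⟨hc, fun c' hc' h' => hc' ?_⟩
  have hij : (⟨0, by omega⟩ : Fin d) ≠ ⟨1, by omega⟩ := by simp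
  rw [← hc]
  exact (h'.speed_unique hij (h.mono one_le_two))
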